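/- Let $n\ge 0$, let $N'=\mathbb Z^{n+1}$ with basis $e_1,\dots,e_{n+1}$, $N=\{\sum a_ie_i : \sum a_i=0\}$, and $v_i=e_i-e_{i+1}$ with indices read cyclically (so $v_{n+1}=e_{n+1}-e_1$). Let $\Sigma$ be the fan in $N$ whose cones are the cones generated by the proper subsets of $\{v_1,\dots,v_{n+1}\}$, and let $W\cong\mathbb P^n$ be its toric variety. (For $n=0$, $W$ is a point and the only cone is $\{0\}$.) Identify $M_{\mathbb Q}=\operatorname{Hom}(N,\mathbb Q)$ with the orthogonal complement of $e_1^*+\dots+e_{n+1}^*$ in $M'_{\mathbb Q}=\mathbb Q^{n+1}$, and give it the inner product induced by the standard one. *Intersection with divisors.* Let $Z_*(W)_{\mathbb Q}$ be the $\mathbb Q$-vector space with basis the cycles $[V(\sigma)]$, $\sigma\in\Sigma$. For $\sigma\in\Sigma$ let $\pi_\sigma$ be the orthogonal projection of $M_{\mathbb Q}$ onto $\sigma^\perp$. A $\mathbb Q$-Cartier divisor $D$ with local equations $m_\tau\in M_{\mathbb Q}/\tau^\perp$ acts on $Z_*(W)_{\mathbb Q}$ by $$D\cdot[V(\sigma)]=\sum_{\tau}\langle\pi_\sigma(m_\tau),n_{\tau,\sigma}\rangle\,[V(\tau)],$$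 where $\tau$ runs over the cones of $\Sigma$ having $\sigma$ as a facet, and $n_{\tau,\sigma}$ is the generator of the image of $\tau\cap N$ in $N/N_\sigma$, with $N_\sigma$ the subgroup generated by $\sigma\cap N$. Let $D_i$ be the divisor whose local equation on $\tau$ takes the value $1$ on $v_i$ if $v_i\in\tau$, and $0$ on the other $v_j\in\tau$. *Ring structure.* The actions of the $D_i$ commute, so $Z_*(W)_{\mathbb Q}$ is a module over $\mathbb Q[Y_1,\dots,Y_{n+1}]$, with $Y_i$ acting as $D_i\cdot{}$; it is generated by $[W]=[V(0)]$. Hence $p\mapsto p\cdot[W]$ identifies $Z_*(W)_{\mathbb Q}$ with a quotient ring of $\mathbb Q[Y_1,\dots,Y_{n+1}]$, which makes it a commutative ring with identity $[W]$. In it the cycle $D_i\cdot[W]$ of $D_i$ (which is $[V(\rho_i)]$, $\rho_i$ the ray through $v_i$, if $n\ge1$), again denoted $D_i$, is nilpotent. *Theorem.* Let $\Phi(x)=\dfrac{x}{1-e^{-x}}$ and let $$t(W)=\prod_{i=1}^{n+1}\Phi(D_i)\in Z_*(W)_{\mathbb Q}$$ be the cycle-level Todd class of $W$. Then for every cone $\sigma\in\Sigma$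 the coefficient of $[V(\sigma)]$ in $t(W)$ equals the fraction of the linear span $L$ of $\sigma$ in $N_{\mathbb R}\subset\mathbb R^{n+1}$ that is contained in $\sigma$, that is, $$\frac{\operatorname{vol}_L\{x\in\sigma:\|x\|\le1\}}{\operatorname{vol}_L\{x\in L:\|x\|\le1\}},$$ where $\|\cdot\|$ and $\operatorname{vol}_L$ come from the standard inner product on $\mathbb R^{n+1}$ (the fraction is $1$ for $\sigma=\{0\}$). -/

import Mathlib

open scoped Nat PowerSeries

namespace ToricProj

/-! ## Lattice, fan and cones -/

/-- The lattice `N = {∑ aᵢ eᵢ | ∑ aᵢ = 0}` inside `N' = ℤ^(n+1)`. -/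
def N (n : ℕ) : AddSubgroup (Fin (n + 1) → ℤ) where
  carrier := {a | ∑ i, a i = 0}
  zero_mem' := by simp
  add_mem' {a b} ha hb := by
    simp only [Set.mem_ofPred_eq, Pi.add_apply, Finset.sum_add_distrib] at *
    rw [ha, hb, add_zero]
  neg_mem' {a} ha := by
    simp only [Set.mem_ofPred_eq, Pi.neg_apply, Finset.sum_neg_distrib] at *
    rw [ha, neg_zero]

/-- The ray generators `vᵢ = eᵢ - eᵢ₊₁`, indices read cyclically
(addition in `Fin (n + 1)` wraps around). -/
def v {n : ℕ} (i : Fin (n + 1)) : N n :=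
  ⟨Pi.single i 1 - Pi.single (i + 1) 1, by
    change ∑ j, (Pi.single i (1 : ℤ) - Pi.single (i + 1) 1 : Fin (n + 1) → ℤ) j = 0
    simp [Finset.sum_sub_distrib]⟩

/-- Lattice points as vectors of the Euclidean space `N'_ℝ = ℝ^(n+1)`. -/
noncomputable def toReal {n : ℕ} (a : N n) : EuclideanSpace ℝ (Fin (n + 1)) :=
  WithLp.toLp 2 (fun i => ((a : Fin (n + 1) → ℤ) i : ℝ))

/-- The cones of the fan `Σ`: one for each proper subset `S` of the set of indices of the `vᵢ`.
The order (inclusion of index sets) is the face relation, so `σ ⋖ τ` says that `σ` is a maximal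
proper face (a facet) of `τ`. -/
abbrev Cone (n : ℕ) : Type := {S : Finset (Fin (n + 1)) // S ≠ Finset.univ}

/-- The cone of `N_ℝ ⊆ ℝ^(n+1)` generated by the `vᵢ`, `i ∈ S`. -/
noncomputable def Cone.toPointedCone {n : ℕ} (σ : Cone n) :
    PointedCone ℝ (EuclideanSpace ℝ (Fin (n + 1))) :=
  PointedCone.hull ℝ ((fun i => toReal (v i)) '' (σ.1 : Set (Fin (n + 1))))

/-- The lattice points `σ ∩ N`. -/
def Cone.latticePoints {n : ℕ} (σ : Cone n) : Set (N n) :=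
  {a | toReal a ∈ σ.toPointedCone}

/-- `N_σ`, the subgroup of `N` generated by `σ ∩ N`. -/
def Cone.sublattice {n : ℕ} (σ : Cone n) : AddSubgroup (N n) :=
  AddSubgroup.closure σ.latticePoints

/-! ## The dual space with its inner product, and the complements -/

/-- `M_ℚ`, the rational dual of `N`, identified with the orthogonal complement of
`e₁* + ⋯ + eₙ₊₁*` in `M'_ℚ = ℚ^(n+1)`. -/
def M (n : ℕ) : Submodule ℚ (Fin (n + 1) → ℚ) where
  carrier := {m | ∑ i, m i = 0}
  zero_mem' := by simp
  add_mem' {a b} ha hb := by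
    simp only [Set.mem_ofPred_eq, Pi.add_apply, Finset.sum_add_distrib] at *
    rw [ha, hb, add_zero]
  smul_mem' c a ha := by
    simp only [Set.mem_ofPred_eq, Pi.smul_apply, smul_eq_mul, ← Finset.mul_sum] at *
    rw [ha, mul_zero]

/-- The duality pairing of `M_ℚ` and `N`. -/
def pairing {n : ℕ} (m : M n) (a : N n) : ℚ :=
  ∑ i, (m : Fin (n + 1) → ℚ) i * ((a : Fin (n + 1) → ℤ) i : ℚ)

/-- The inner product on `M_ℚ` induced by the standard one on `M'_ℚ`. -/
def innerM (n : ℕ) : LinearMap.BilinForm ℚ (M n) :=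
  LinearMap.mk₂ ℚ (fun x y => ∑ i, (x : Fin (n + 1) → ℚ) i * (y : Fin (n + 1) → ℚ) i)
    (by intros; simp [add_mul, Finset.sum_add_distrib])
    (by intros; simp [mul_assoc, Finset.mul_sum])
    (by intros; simp [mul_add, Finset.sum_add_distrib])
    (by intros; simp only [Submodule.coe_smul, Pi.smul_apply, smul_eq_mul, Finset.mul_sum]
        exact Finset.sum_congr rfl fun i _ => by ring)

/-- `M(σ)_ℚ = σ^⊥`, the elements of `M_ℚ` that vanish on `σ`. -/
def Cone.perp {n : ℕ} (σ : Cone n) : Submodule ℚ (M n) where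
  carrier := {m | ∀ a ∈ σ.latticePoints, pairing m a = 0}
  zero_mem' := by intro a _; simp [pairing]
  add_mem' {x y} hx hy := by
    intro a ha
    have h1 := hx a ha
    have h2 := hy a ha
    simp only [pairing] at h1 h2
    simp [pairing, add_mul, Finset.sum_add_distrib, h1, h2]
  smul_mem' c x hx := by
    intro a ha
    have h1 := hx a ha
    simp only [pairing] at h1
    simp [pairing, mul_assoc, ← Finset.mul_sum, h1]

/-- The choice of complements given by the inner product: `Ψ(σ)` is the orthogonal complement
of `σ^⊥` in `M_ℚ`. -/
def Cone.complement {n : ℕ} (σ : Cone n) : Submodule ℚ (M n) :=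
  (innerM n).orthogonal σ.perp

theorem innerM_apply {n : ℕ} (x y : M n) :
    innerM n x y = ∑ i, (x : Fin (n + 1) → ℚ) i * (y : Fin (n + 1) → ℚ) i := rfl

theorem innerM_comm {n : ℕ} (x y : M n) : innerM n x y = innerM n y x := by
  simp only [innerM_apply, mul_comm]

theorem innerM_self_eq_zero {n : ℕ} {x : M n} (h : innerM n x x = 0) : x = 0 := by
  rw [innerM_apply, Finset.sum_eq_zero_iff_of_nonneg (fun i _ => mul_self_nonneg _)] at h
  ext i
  simpa using h i (Finset.mem_univ i)

theorem isCompl_complement {n : ℕ} (σ : Cone n) : IsCompl σ.perp σ.complement := by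
  have hr : (innerM n).IsRefl := fun x y h => by rw [innerM_comm]; exact h
  refine (LinearMap.BilinForm.isCompl_orthogonal_iff_disjoint hr).2 ?_
  rw [Submodule.disjoint_def]
  intro x hx hy
  exact innerM_self_eq_zero ((LinearMap.BilinForm.mem_orthogonal_iff.1 hy) x hx)

/-- `π_σ`, the projection of `M_ℚ = M(σ)_ℚ ⊕ Ψ(σ)` onto `M(σ)_ℚ`. -/
noncomputable def Cone.proj {n : ℕ} (σ : Cone n) : M n →ₗ[ℚ] M n :=
  σ.perp.projection σ.complement (isCompl_complement σ)

/-! ## Divisors and their action on cycles -/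

/-- An equivariant `ℚ`-Cartier divisor, given by its local equations
`m_σ ∈ M_ℚ / M(σ)_ℚ`: `localEq σ` is a representative of `m_σ`, and `agree` says that
`m_σ` is mapped to `m_τ` for each face `τ` of `σ`. -/
structure Divisor (n : ℕ) where
  localEq : Cone n → M n
  agree : ∀ τ σ : Cone n, τ ≤ σ → localEq σ - localEq τ ∈ τ.perp

/-- `u ∈ N` represents the generator `n_{τ,σ}` of the image of `τ ∩ N` in `N(σ) = N / N_σ`
(for `σ` a facet of `τ`, the first lattice point on the ray of `N(σ)` that corresponds to `τ`):
`u` lies in `τ ∩ N`, and modulo `N_σ` each point of `τ ∩ N` is a multiple of `u`. -/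
def IsRayGenerator {n : ℕ} (τ σ : Cone n) (u : N n) : Prop :=
  u ∈ τ.latticePoints ∧ ∀ a ∈ τ.latticePoints, ∃ c : ℕ, a - c • u ∈ σ.sublattice

/-- A representative in `N` of `n_{τ,σ} ∈ N(σ)`; it exists by `exists_isRayGenerator`. -/
noncomputable def rayGenerator {n : ℕ} (τ σ : Cone n) : N n :=
  Classical.epsilon (IsRayGenerator τ σ)

/-- `Z_*(W)_ℚ`, the invariant cycles of `W` with rational coefficients: the `ℚ`-vector space
with basis the `[V(σ)]`, `σ ∈ Σ`. -/
def Cycle (n : ℕ) : Type := Cone n →₀ ℚ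

noncomputable instance (n : ℕ) : AddCommGroup (Cycle n) :=
  inferInstanceAs (AddCommGroup (Cone n →₀ ℚ))

noncomputable instance (n : ℕ) : Module ℚ (Cycle n) :=
  inferInstanceAs (Module ℚ (Cone n →₀ ℚ))

/-- The cycle `[V(σ)]`. -/
noncomputable def cycleOf {n : ℕ} (σ : Cone n) : Cycle n :=
  (Finsupp.single σ 1 : Cone n →₀ ℚ)

/-- The coefficient of `[V(σ)]` in a cycle. -/
def Cycle.coeff {n : ℕ} (z : Cycle n) (σ : Cone n) : ℚ :=
  (show Cone n →₀ ℚ from z) σ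

/-- The zero cone. -/
def zeroCone (n : ℕ) : Cone n := ⟨∅, Finset.univ_nonempty.ne_empty.symm⟩

/-- The fundamental cycle `[W] = [V(0)]`. -/
noncomputable def fundamental (n : ℕ) : Cycle n := cycleOf (zeroCone n)

open Classical in
/-- The action of a divisor on cycles:
`D · [V(σ)] = ∑ ⟨π_σ(m_τ), n_{τ,σ}⟩ [V(τ)]`, the sum over the cones `τ` that have `σ` as a
facet. -/
noncomputable def Divisor.act {n : ℕ} (D : Divisor n) : Cycle n →ₗ[ℚ] Cycle n :=
  Finsupp.linearCombination ℚ (fun σ : Cone n =>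
    ∑ τ : Cone n with σ ⋖ τ,
      pairing (σ.proj (D.localEq τ)) (rayGenerator τ σ) • cycleOf τ)

/-! ### The divisors `Dᵢ` -/

/-- For `i ≠ k` there is an integral functional that takes the value `1` on `vᵢ` and `0` on the
other `vⱼ`, `j ≠ k`. -/
theorem exists_dual {n : ℕ} (k i : Fin (n + 1)) :
    ∃ g : Fin (n + 1) → ℤ, ∀ j, j ≠ k → g j - g (j + 1) = if j = i then 1 else 0 := by
  refine ⟨fun j => if (j - (k + 1)).val ≤ (i - (k + 1)).val then 1 else 0, fun j hj => ?_⟩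
  have hd : j - (k + 1) ≠ Fin.last n := by
    intro h
    apply hj
    have h2 : (Fin.last n) + 1 = 0 := Fin.last_add_one n
    have h3 : j = (j - (k + 1)) + 1 + k := by abel
    rw [h3, h, h2, zero_add]
  have hlt : j - (k + 1) < Fin.last n := Fin.lt_last_iff_ne_last.2 hd
  have h1 : j + 1 - (k + 1) = (j - (k + 1)) + 1 := by abel
  have h2 : (j + 1 - (k + 1)).val = (j - (k + 1)).val + 1 := by
    rw [h1, Fin.val_add_one_of_lt hlt]
  have h3 : j = i ↔ (j - (k + 1)).val = (i - (k + 1)).val := by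
    rw [← Fin.ext_iff, sub_left_inj]
  simp only [h2, h3]
  split_ifs <;> omega

theorem pairing_v {n : ℕ} (m : M n) (i : Fin (n + 1)) :
    pairing m (v i) = (m : Fin (n + 1) → ℚ) i - (m : Fin (n + 1) → ℚ) (i + 1) := by
  simp [pairing, v, mul_sub, Finset.sum_sub_distrib, Pi.single_apply]

/-- For each cone, the local equation of `Dᵢ` exists. -/
theorem exists_localEq {n : ℕ} (i : Fin (n + 1)) (σ : Cone n) :
    ∃ m : M n, ∀ j ∈ σ.1, pairing m (v j) = if j = i then 1 else 0 := by
  obtain ⟨k, hk⟩ : ∃ k, k ∉ σ.1 := by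
    by_contra! h
    exact σ.2 (Finset.eq_univ_iff_forall.2 h)
  obtain ⟨g, hg⟩ := exists_dual k i
  refine ⟨⟨fun j => (g j : ℚ) - (∑ l, (g l : ℚ)) / (n + 1), ?_⟩, fun j hj => ?_⟩
  · change ∑ j, ((g j : ℚ) - (∑ l, (g l : ℚ)) / (n + 1)) = 0
    rw [Finset.sum_sub_distrib]
    have : (n + 1 : ℚ) ≠ 0 := by positivity
    simp [mul_div_cancel₀, this]
  · rw [pairing_v]
    have h := hg j (fun h => hk (h ▸ hj))
    have h' : ((g j - g (j + 1) : ℤ) : ℚ) = ((if j = i then 1 else 0 : ℤ) : ℚ) := by rw [h]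
    push_cast at h'
    simpa using h'

theorem toReal_add {n : ℕ} (a b : N n) : toReal (a + b) = toReal a + toReal b := by
  ext i; simp [toReal]

theorem mem_toPointedCone_iff {n : ℕ} (σ : Cone n) (x : EuclideanSpace ℝ (Fin (n + 1))) :
    x ∈ σ.toPointedCone ↔
      ∃ c : Fin (n + 1) → {r : ℝ // 0 ≤ r}, ∑ i ∈ σ.1, c i • toReal (v i) = x := by
  rw [Cone.toPointedCone, PointedCone.hull]
  exact Submodule.mem_span_image_finset_iff_exists_fun' _

theorem v_mem_latticePoints {n : ℕ} {σ : Cone n} {i : Fin (n + 1)} (hi : i ∈ σ.1) :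
    v i ∈ σ.latticePoints :=
  Submodule.subset_span ⟨i, hi, rfl⟩

/-- The lattice points of a cone are the combinations of its ray generators with
coefficients in `ℕ`. -/
theorem exists_eq_sum {n : ℕ} {σ : Cone n} {a : N n} (ha : a ∈ σ.latticePoints) :
    ∃ c : Fin (n + 1) → ℕ, a = ∑ i ∈ σ.1, c i • v i := by
  obtain ⟨c, hc⟩ := (mem_toPointedCone_iff σ _).1 ha
  obtain ⟨k, hk⟩ : ∃ k, k ∉ σ.1 := by
    by_contra! h
    exact σ.2 (Finset.eq_univ_iff_forall.2 h)
  have hcoord : ∀ l, ∑ i ∈ σ.1, (c i : ℝ) * (((v i : N n) : Fin (n + 1) → ℤ) l : ℝ)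
      = ((a : Fin (n + 1) → ℤ) l : ℝ) := by
    intro l
    have := congrArg (fun x : EuclideanSpace ℝ (Fin (n + 1)) => x l) hc
    simp only [toReal] at this
    rw [← this]
    simp only [WithLp.ofLp_sum, Finset.sum_apply]
    exact Finset.sum_congr rfl fun i _ => rfl
  have hint : ∀ i, ∃ d : ℕ, i ∈ σ.1 → (c i : ℝ) = d := by
    intro i
    by_cases hi : i ∈ σ.1
    · obtain ⟨g, hg⟩ := exists_dual k i
      have h1 : ∀ j ∈ σ.1, ∑ l, (g l : ℝ) * (((v j : N n) : Fin (n + 1) → ℤ) l : ℝ)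
          = if j = i then 1 else 0 := by
        intro j hj
        have h := hg j (fun h => hk (h ▸ hj))
        have h' : ((g j - g (j + 1) : ℤ) : ℝ) = ((if j = i then 1 else 0 : ℤ) : ℝ) := by rw [h]
        push_cast at h'
        rw [← h']
        simp [v, mul_sub, Finset.sum_sub_distrib, Pi.single_apply]
      have h2 : (c i : ℝ) = ((∑ l, g l * (a : Fin (n + 1) → ℤ) l : ℤ) : ℝ) := by
        push_cast
        simp only [← hcoord, Finset.mul_sum]
        rw [Finset.sum_comm]
        have : ∀ j ∈ σ.1, ∑ l, (g l : ℝ) * ((c j : ℝ) * (((v j : N n) : Fin (n + 1) → ℤ) l : ℝ))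
            = if j = i then (c i : ℝ) else 0 := by
          intro j hj
          calc _ = (c j : ℝ) * ∑ l, (g l : ℝ) * (((v j : N n) : Fin (n + 1) → ℤ) l : ℝ) := by
                rw [Finset.mul_sum]; exact Finset.sum_congr rfl fun l _ => by ring
            _ = _ := by rw [h1 j hj]; split_ifs with h <;> simp [h]
        rw [Finset.sum_congr rfl this]
        simp [hi]
      have h3 : 0 ≤ ∑ l, g l * (a : Fin (n + 1) → ℤ) l := by
        have := (c i).2
        rw [h2] at this
        exact_mod_cast this
      refine ⟨(∑ l, g l * (a : Fin (n + 1) → ℤ) l).toNat, fun _ => ?_⟩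
      rw [h2]
      exact_mod_cast (Int.toNat_of_nonneg h3).symm
    · exact ⟨0, fun h => absurd h hi⟩
  choose d hd using hint
  refine ⟨d, ?_⟩
  ext l
  have h := hcoord l
  rw [Finset.sum_congr rfl fun i hi => by rw [hd i hi]] at h
  have h' : ∑ i ∈ σ.1, (d i : ℤ) * ((v i : N n) : Fin (n + 1) → ℤ) l
      = (a : Fin (n + 1) → ℤ) l := by exact_mod_cast h
  rw [← h']
  simp

/-- Elements of `N` as elements of `M_ℚ`; the pairing is the inner product. -/
def emb {n : ℕ} (a : N n) : M n :=
  ⟨fun i => ((a : Fin (n + 1) → ℤ) i : ℚ), by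
    have h : ∑ i, (a : Fin (n + 1) → ℤ) i = 0 := a.2
    change ∑ i, ((a : Fin (n + 1) → ℤ) i : ℚ) = 0
    exact_mod_cast h⟩

theorem pairing_eq_innerM {n : ℕ} (m : M n) (a : N n) : pairing m a = innerM n m (emb a) := rfl

/-- The pairing with a fixed element of `M_ℚ`, as a homomorphism. -/
def pairingHom {n : ℕ} (m : M n) : N n →+ ℚ where
  toFun := pairing m
  map_zero' := by simp [pairing]
  map_add' a b := by simp [pairing, mul_add, Finset.sum_add_distrib]

theorem mem_perp_iff {n : ℕ} {σ : Cone n} {m : M n} :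
    m ∈ σ.perp ↔ ∀ i ∈ σ.1, pairing m (v i) = 0 := by
  refine ⟨fun h i hi => h _ (v_mem_latticePoints hi), fun h a ha => ?_⟩
  obtain ⟨c, rfl⟩ := exists_eq_sum ha
  change pairingHom m _ = 0
  rw [map_sum]
  refine Finset.sum_eq_zero fun i hi => ?_
  rw [map_nsmul]
  change _ • pairing m (v i) = 0
  rw [h i hi, smul_zero]

theorem perp_anti {n : ℕ} {σ τ : Cone n} (h : σ ≤ τ) : τ.perp ≤ σ.perp :=
  fun _ hm => mem_perp_iff.2 fun i hi => mem_perp_iff.1 hm i (h hi)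

/-- The divisor `Dᵢ`: its local equation `m_σ` takes the value `1` on `vᵢ` (if `vᵢ` lies on
`σ`), and the value `0` on the other ray generators of `σ`. -/
noncomputable def primeDivisor {n : ℕ} (i : Fin (n + 1)) : Divisor n where
  localEq σ := (exists_localEq i σ).choose
  agree τ σ h := by
    refine mem_perp_iff.2 fun j hj => ?_
    have h1 := (exists_localEq i σ).choose_spec j (h hj)
    have h2 := (exists_localEq i τ).choose_spec j hj
    rw [pairing_eq_innerM] at h1 h2 ⊢
    rw [map_sub, LinearMap.sub_apply, h1, h2, sub_self]

theorem primeDivisor_spec {n : ℕ} (i : Fin (n + 1)) (σ : Cone n) (j : Fin (n + 1))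
    (hj : j ∈ σ.1) :
    pairing ((primeDivisor i).localEq σ) (v j) = if j = i then 1 else 0 :=
  (exists_localEq i σ).choose_spec j hj

theorem primeDivisor_mem_perp {n : ℕ} {σ τ : Cone n} {k : Fin (n + 1)} (hk : k ∉ σ.1)
    (hτ : τ.1 = insert k σ.1) : (primeDivisor k).localEq τ ∈ σ.perp := by
  refine mem_perp_iff.2 fun i hi => ?_
  have hne : i ≠ k := by
    rintro rfl
    exact hk hi
  rw [primeDivisor_spec k τ i (by rw [hτ]; exact Finset.mem_insert_of_mem hi), if_neg hne]

/-! ### The coefficients of the action -/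

theorem covBy_iff {n : ℕ} {σ τ : Cone n} : σ ⋖ τ ↔ ∃ k, k ∉ σ.1 ∧ τ.1 = insert k σ.1 := by
  constructor
  · intro h
    obtain ⟨k, hk, hkσ⟩ := Finset.exists_of_ssubset (show σ.1 ⊂ τ.1 from h.lt)
    refine ⟨k, hkσ, ?_⟩
    have hsub : insert k σ.1 ⊆ τ.1 := Finset.insert_subset hk h.le
    have hne : insert k σ.1 ≠ Finset.univ := fun he => by
      rw [he] at hsub
      exact τ.2 (Finset.univ_subset_iff.1 hsub)
    by_contra hcon
    refine h.2 (c := ⟨insert k σ.1, hne⟩) ?_ ?_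
    · exact Finset.ssubset_insert hkσ
    · exact Finset.ssubset_iff_subset_ne.2 ⟨hsub, fun he => hcon he.symm⟩
  · rintro ⟨k, hk, hτ⟩
    refine ⟨?_, fun ρ h1 h2 => ?_⟩
    · change σ.1 ⊂ τ.1
      rw [hτ]; exact Finset.ssubset_insert hk
    · have h1' := Finset.card_lt_card (show σ.1 ⊂ ρ.1 from h1)
      have h2' := Finset.card_lt_card (show ρ.1 ⊂ τ.1 from h2)
      rw [hτ, Finset.card_insert_of_notMem hk] at h2'
      omega

theorem exists_isRayGenerator {n : ℕ} {σ τ : Cone n} (h : σ ⋖ τ) :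
    ∃ u, IsRayGenerator τ σ u := by
  obtain ⟨k, hk, hτ⟩ := covBy_iff.1 h
  refine ⟨v k, v_mem_latticePoints (by rw [hτ]; exact Finset.mem_insert_self _ _),
    fun a ha => ?_⟩
  obtain ⟨c, rfl⟩ := exists_eq_sum ha
  refine ⟨c k, ?_⟩
  rw [hτ, Finset.sum_insert hk, add_sub_cancel_left]
  exact sum_mem fun i hi =>
    nsmul_mem (AddSubgroup.subset_closure (v_mem_latticePoints hi)) _

theorem pairing_eq_zero_of_mem_sublattice {n : ℕ} {σ : Cone n} {m : M n} (hm : m ∈ σ.perp)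
    {a : N n} (ha : a ∈ σ.sublattice) : pairing m a = 0 := by
  have : σ.sublattice ≤ (pairingHom m).ker :=
    (AddSubgroup.closure_le _).2 fun b hb => hm b hb
  exact this ha

/-- The class `n_{τ,σ}` is that of `v_k`, where `v_k` is the ray generator on `τ` not on `σ`. -/
theorem pairing_rayGenerator {n : ℕ} {σ τ : Cone n} {k : Fin (n + 1)} (hk : k ∉ σ.1)
    (hτ : τ.1 = insert k σ.1) {m : M n} (hm : m ∈ σ.perp) :
    pairing m (rayGenerator τ σ) = pairing m (v k) := by
  have hcov : σ ⋖ τ := covBy_iff.2 ⟨k, hk, hτ⟩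
  have hkτ : k ∈ τ.1 := by rw [hτ]; exact Finset.mem_insert_self _ _
  obtain ⟨hu, hgen⟩ : IsRayGenerator τ σ (rayGenerator τ σ) :=
    Classical.epsilon_spec (exists_isRayGenerator hcov)
  obtain ⟨c, hc⟩ := hgen (v k) (v_mem_latticePoints hkτ)
  obtain ⟨d, hd⟩ := exists_eq_sum hu
  have key : ∀ x ∈ σ.perp, pairing x (v k) = c * pairing x (rayGenerator τ σ) := by
    intro x hx
    have h := pairing_eq_zero_of_mem_sublattice hx hc
    change pairingHom x _ = 0 at h
    rw [map_sub, map_nsmul, sub_eq_zero, nsmul_eq_mul] at h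
    exact h
  have key2 : ∀ x ∈ σ.perp, pairing x (rayGenerator τ σ) = d k * pairing x (v k) := by
    intro x hx
    rw [hd, hτ]
    change pairingHom x _ = _
    rw [map_sum, Finset.sum_insert hk, map_nsmul, nsmul_eq_mul, Finset.sum_eq_zero, add_zero]
    · rfl
    · intro i hi
      rw [map_nsmul]
      change _ • pairing x (v i) = 0
      rw [mem_perp_iff.1 hx i hi, smul_zero]
  set x := (primeDivisor k).localEq τ
  have hx : x ∈ σ.perp := primeDivisor_mem_perp hk hτ
  have hx1 : pairing x (v k) = 1 := by
    rw [primeDivisor_spec k τ k hkτ, if_pos rfl]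
  have h1 := key x hx
  rw [key2 x hx, hx1, mul_one] at h1
  have hc1 : c = 1 := by
    have h2 : c * d k = 1 := by exact_mod_cast h1.symm
    exact Nat.eq_one_of_mul_eq_one_right h2
  rw [key m hm, hc1, Nat.cast_one, one_mul]

theorem proj_mem {n : ℕ} (σ : Cone n) (m : M n) : σ.proj m ∈ σ.perp := by
  simp [Cone.proj]

theorem proj_of_mem {n : ℕ} {σ : Cone n} {m : M n} (h : m ∈ σ.perp) : σ.proj m = m := by
  simp [Cone.proj, Submodule.projection_apply, Submodule.projectionOnto_apply_of_mem_left _ h]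

theorem sub_proj_mem {n : ℕ} (σ : Cone n) (m : M n) : m - σ.proj m ∈ σ.complement := by
  have h : (σ.perp.projectionOnto σ.complement (isCompl_complement σ)) (m - σ.proj m) = 0 := by
    rw [map_sub, Cone.proj, Submodule.projectionOnto_projection, sub_self]
  exact (Submodule.projectionOnto_apply_eq_zero_iff _).1 h

theorem innerM_perp_complement {n : ℕ} {σ : Cone n} {x y : M n} (hx : x ∈ σ.perp)
    (hy : y ∈ σ.complement) : innerM n x y = 0 :=
  (LinearMap.BilinForm.mem_orthogonal_iff.1 hy) x hx

theorem innerM_proj_left {n : ℕ} (σ : Cone n) (x y : M n) :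
    innerM n (σ.proj x) y = innerM n (σ.proj x) (σ.proj y) := by
  have := innerM_perp_complement (proj_mem σ x) (sub_proj_mem σ y)
  rwa [map_sub, sub_eq_zero] at this

theorem innerM_proj {n : ℕ} (σ : Cone n) (x y : M n) :
    innerM n (σ.proj x) y = innerM n x (σ.proj y) := by
  rw [innerM_proj_left, innerM_comm x, innerM_proj_left σ y x, innerM_comm]

theorem emb_mem_complement {n : ℕ} {σ : Cone n} {k : Fin (n + 1)} (hk : k ∈ σ.1) :
    emb (v k) ∈ σ.complement :=
  LinearMap.BilinForm.mem_orthogonal_iff.2 fun _ hx => mem_perp_iff.1 hx k hk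

theorem complement_mono {n : ℕ} {σ τ : Cone n} (h : σ ≤ τ) : σ.complement ≤ τ.complement :=
  LinearMap.BilinForm.orthogonal_le (perp_anti h)

open Classical in
/-- The coefficient of `[V(τ)]` in `D · [V(σ)]`. -/
noncomputable def Divisor.coef {n : ℕ} (D : Divisor n) (σ τ : Cone n) : ℚ :=
  if σ ⋖ τ then pairing (σ.proj (D.localEq τ)) (rayGenerator τ σ) else 0

theorem act_cycleOf {n : ℕ} (D : Divisor n) (σ : Cone n) :
    D.act (cycleOf σ) = ∑ τ, D.coef σ τ • cycleOf τ := by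
  classical
  have h : D.act (cycleOf σ) = (1 : ℚ) • ∑ τ : Cone n with σ ⋖ τ,
      pairing (σ.proj (D.localEq τ)) (rayGenerator τ σ) • cycleOf τ :=
    Finsupp.linearCombination_single ℚ (1 : ℚ) σ
  rw [h, one_smul, Finset.sum_filter]
  refine Finset.sum_congr rfl fun τ _ => ?_
  simp only [Divisor.coef]
  split_ifs <;> simp

theorem coef_of_insert {n : ℕ} (D : Divisor n) {σ τ ω : Cone n} {k : Fin (n + 1)}
    (hk : k ∉ σ.1) (hτ : τ.1 = insert k σ.1) (hω : τ ≤ ω) :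
    D.coef σ τ = innerM n (D.localEq ω) (σ.proj (emb (v k))) := by
  have hcov : σ ⋖ τ := covBy_iff.2 ⟨k, hk, hτ⟩
  have hkτ : k ∈ τ.1 := by rw [hτ]; exact Finset.mem_insert_self _ _
  have hd := D.agree τ ω hω
  have h0 : innerM n (D.localEq ω - D.localEq τ) (σ.proj (emb (v k))) = 0 := by
    rw [← innerM_proj, proj_of_mem (perp_anti hcov.le hd), ← pairing_eq_innerM]
    exact mem_perp_iff.1 hd k hkτ
  rw [map_sub, LinearMap.sub_apply, sub_eq_zero] at h0
  rw [Divisor.coef, if_pos hcov, pairing_rayGenerator hk hτ (proj_mem _ _), pairing_eq_innerM,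
    innerM_proj, h0]

theorem proj_emb_ne_zero {n : ℕ} {σ τ : Cone n} {k : Fin (n + 1)} (hk : k ∉ σ.1)
    (hτ : τ.1 = insert k σ.1) :
    innerM n (σ.proj (emb (v k))) (σ.proj (emb (v k))) ≠ 0 := by
  intro h
  have h0 := innerM_self_eq_zero h
  have hkτ : k ∈ τ.1 := by rw [hτ]; exact Finset.mem_insert_self _ _
  have hx : (primeDivisor k).localEq τ ∈ σ.perp := primeDivisor_mem_perp hk hτ
  have h1 := primeDivisor_spec k τ k hkτ
  rw [if_pos rfl, pairing_eq_innerM, ← proj_of_mem hx, innerM_proj, h0, map_zero] at h1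
  exact zero_ne_one h1

theorem proj_insert {n : ℕ} {σ τ : Cone n} {k : Fin (n + 1)} (hk : k ∉ σ.1)
    (hτ : τ.1 = insert k σ.1) (y : M n) :
    τ.proj y = σ.proj y - (innerM n (σ.proj (emb (v k))) (σ.proj y) /
      innerM n (σ.proj (emb (v k))) (σ.proj (emb (v k)))) • σ.proj (emb (v k)) := by
  have hne := proj_emb_ne_zero hk hτ
  have hle : σ ≤ τ := (covBy_iff.2 ⟨k, hk, hτ⟩).le
  have hkτ : k ∈ τ.1 := by rw [hτ]; exact Finset.mem_insert_self _ _
  set a := σ.proj (emb (v k)) with ha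
  set b := σ.proj y with hb
  set t := innerM n a b / innerM n a a with ht
  have haσ : a ∈ σ.perp := proj_mem _ _
  have hbσ : b ∈ σ.perp := proj_mem _ _
  have haΨ : a ∈ τ.complement := by
    have h1 := complement_mono hle (sub_proj_mem σ (emb (v k)))
    have h2 := Submodule.sub_mem _ (emb_mem_complement hkτ) h1
    rwa [sub_sub_cancel] at h2
  have hmem : b - t • a ∈ τ.perp := by
    refine mem_perp_iff.2 fun i hi => ?_
    rw [hτ, Finset.mem_insert] at hi
    rcases hi with rfl | hi
    · rw [pairing_eq_innerM]
      have h1 : innerM n b (emb (v i)) = innerM n a b := by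
        rw [hb, innerM_proj_left, innerM_comm]
      have h2 : innerM n a (emb (v i)) = innerM n a a := by
        rw [ha, innerM_proj_left]
      rw [map_sub, map_smul, LinearMap.sub_apply, LinearMap.smul_apply, h1, h2, smul_eq_mul, ht,
        div_mul_cancel₀ _ hne, sub_self]
    · exact mem_perp_iff.1 (Submodule.sub_mem _ hbσ (Submodule.smul_mem _ _ haσ)) i hi
  have hcom : y - (b - t • a) ∈ τ.complement := by
    have : y - (b - t • a) = (y - b) + t • a := by abel
    rw [this]
    exact Submodule.add_mem _ (complement_mono hle (sub_proj_mem σ y))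
      (Submodule.smul_mem _ _ haΨ)
  have h0 : τ.proj (y - (b - t • a)) = 0 := by
    simp [Cone.proj, Submodule.projection_apply,
      (Submodule.projectionOnto_apply_eq_zero_iff (isCompl_complement τ)).2 hcom]
  rw [map_sub, proj_of_mem hmem, sub_eq_zero] at h0
  exact h0

/-! ### Commutativity -/

theorem sum_coef_comm {n : ℕ} (D E : Divisor n) (σ ω : Cone n) :
    ∑ τ, D.coef σ τ * E.coef τ ω = ∑ τ, E.coef σ τ * D.coef τ ω := by
  classical
  by_cases hex : ∃ τ : Cone n, σ ⋖ τ ∧ τ ⋖ ω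
  · obtain ⟨τ₁, h1, h2⟩ := hex
    obtain ⟨k, hk, hτ₁⟩ := covBy_iff.1 h1
    obtain ⟨l, hl, hω⟩ := covBy_iff.1 h2
    have hlσ : l ∉ σ.1 := fun h => hl (h1.le h)
    have hlk : l ≠ k := fun h => hl (by rw [hτ₁, h]; exact Finset.mem_insert_self _ _)
    have hω' : ω.1 = insert k (insert l σ.1) := by rw [hω, hτ₁, Finset.insert_comm]
    have hk2 : k ∉ insert l σ.1 := by
      rw [Finset.mem_insert, not_or]; exact ⟨hlk.symm, hk⟩
    let τ₂ : Cone n := ⟨insert l σ.1, fun he => hk2 (by rw [he]; exact Finset.mem_univ k)⟩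
    have hτ₂ : τ₂.1 = insert l σ.1 := rfl
    have hω₂ : ω.1 = insert k τ₂.1 := hω'
    have hkτ₂ : k ∉ τ₂.1 := hk2
    have h2' : τ₂ ⋖ ω := covBy_iff.2 ⟨k, hkτ₂, hω₂⟩
    have hne : τ₁ ≠ τ₂ := fun he => hkτ₂ (by
      rw [← he, hτ₁]; exact Finset.mem_insert_self _ _)
    have hsum : ∀ A B : Divisor n, ∑ τ, A.coef σ τ * B.coef τ ω
        = A.coef σ τ₁ * B.coef τ₁ ω + A.coef σ τ₂ * B.coef τ₂ ω := by
      intro A B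
      rw [← Finset.sum_pair (f := fun τ => A.coef σ τ * B.coef τ ω) hne]
      symm
      refine Finset.sum_subset (Finset.subset_univ _) fun τ _ hτ => ?_
      by_cases ha : σ ⋖ τ
      · by_cases hb : τ ⋖ ω
        · exfalso
          apply hτ
          obtain ⟨j, hj, hτj⟩ := covBy_iff.1 ha
          have hjω : j ∈ ω.1 := hb.le (by rw [hτj]; exact Finset.mem_insert_self _ _)
          rw [hω', Finset.mem_insert, Finset.mem_insert] at hjω
          rw [Finset.mem_insert, Finset.mem_singleton]
          rcases hjω with rfl | rfl | hjσ
          · exact Or.inl (Subtype.ext (hτj.trans hτ₁.symm))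
          · exact Or.inr (Subtype.ext hτj)
          · exact absurd hjσ hj
        · simp [Divisor.coef, hb]
      · simp [Divisor.coef, ha]
    rw [hsum, hsum]
    have c1 : ∀ A : Divisor n, A.coef σ τ₁ = _ := fun A => coef_of_insert A hk hτ₁ h2.le
    have c2 : ∀ A : Divisor n, A.coef σ τ₂ = _ := fun A => coef_of_insert A hlσ hτ₂ h2'.le
    have c3 : ∀ A : Divisor n, A.coef τ₁ ω = _ := fun A => coef_of_insert A hl hω le_rfl
    have c4 : ∀ A : Divisor n, A.coef τ₂ ω = _ := fun A => coef_of_insert A hkτ₂ hω₂ le_rfl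
    simp only [c1, c2, c3, c4, proj_insert hk hτ₁, proj_insert hlσ hτ₂, map_sub, map_smul,
      smul_eq_mul]
    ring
  · have hz : ∀ A B : Divisor n, ∑ τ, A.coef σ τ * B.coef τ ω = 0 := by
      intro A B
      refine Finset.sum_eq_zero fun τ _ => ?_
      by_cases ha : σ ⋖ τ
      · have hb : ¬ τ ⋖ ω := fun hb => hex ⟨τ, ha, hb⟩
        simp [Divisor.coef, hb]
      · simp [Divisor.coef, ha]
    rw [hz, hz]

theorem cycle_hom_ext {n : ℕ} {f g : Cycle n →ₗ[ℚ] Cycle n}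
    (h : ∀ σ, f (cycleOf σ) = g (cycleOf σ)) : f = g :=
  Finsupp.lhom_ext' fun σ => LinearMap.ext_ring (h σ)

/-- The actions of two divisors commute. -/
theorem act_comm {n : ℕ} (D E : Divisor n) : D.act * E.act = E.act * D.act := by
  refine cycle_hom_ext fun σ => ?_
  have h : ∀ A B : Divisor n, (A.act * B.act) (cycleOf σ)
      = ∑ ω, (∑ τ, B.coef σ τ * A.coef τ ω) • cycleOf ω := by
    intro A B
    rw [Module.End.mul_apply, act_cycleOf, map_sum]
    simp only [map_smul, act_cycleOf, Finset.smul_sum, smul_smul, Finset.sum_smul]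
    rw [Finset.sum_comm]
  rw [h, h]
  exact Finset.sum_congr rfl fun ω _ => by rw [sum_coef_comm]

/-! ## The ring structure on cycles -/

open scoped IsMulCommutative in
/-- `Z_*(W)_ℚ` is a module over `ℚ[Y₁, …, Yₙ₊₁]`, the variable `Yᵢ` acting by `Dᵢ ·`. This is the
corresponding homomorphism to the endomorphisms of `Z_*(W)_ℚ`. -/
noncomputable def polyAct (n : ℕ) :
    MvPolynomial (Fin (n + 1)) ℚ →ₐ[ℚ] Module.End ℚ (Cycle n) :=
  haveI : IsMulCommutative (Algebra.adjoin ℚ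
      (Set.range fun i : Fin (n + 1) => (primeDivisor i).act)) :=
    Algebra.isMulCommutative_adjoin ℚ (by
      rintro _ ⟨i, rfl⟩ _ ⟨j, rfl⟩
      exact act_comm _ _)
  (Algebra.adjoin ℚ (Set.range fun i : Fin (n + 1) => (primeDivisor i).act)).val.comp
    (MvPolynomial.aeval fun i => ⟨(primeDivisor i).act, Algebra.subset_adjoin ⟨i, rfl⟩⟩)

theorem polyAct_X {n : ℕ} (i : Fin (n + 1)) :
    polyAct n (MvPolynomial.X i) = (primeDivisor i).act := by
  simp [polyAct]

/-- The map `α : ℚ[Y₁, …, Yₙ₊₁] → Z_*(W)_ℚ`, `p ↦ p · [W]`. -/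
noncomputable def alpha (n : ℕ) : MvPolynomial (Fin (n + 1)) ℚ →ₗ[ℚ] Cycle n :=
  (LinearMap.applyₗ (fundamental n)).comp (polyAct n).toLinearMap

theorem alpha_apply {n : ℕ} (p : MvPolynomial (Fin (n + 1)) ℚ) :
    alpha n p = polyAct n p (fundamental n) := rfl

/-- `D_k · [V(σ)] = [V(σ + ρ_k)]` if `ρ_k` is not a ray of `σ`. -/
theorem primeDivisor_act {n : ℕ} {σ τ : Cone n} {k : Fin (n + 1)} (hk : k ∉ σ.1)
    (hτ : τ.1 = insert k σ.1) : (primeDivisor k).act (cycleOf σ) = cycleOf τ := by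
  have hkτ : k ∈ τ.1 := by rw [hτ]; exact Finset.mem_insert_self _ _
  rw [act_cycleOf, Finset.sum_eq_single τ]
  · have hx : (primeDivisor k).localEq τ ∈ σ.perp := primeDivisor_mem_perp hk hτ
    rw [coef_of_insert _ hk hτ le_rfl, ← innerM_proj, proj_of_mem hx, ← pairing_eq_innerM,
      primeDivisor_spec k τ k hkτ, if_pos rfl, one_smul]
  · intro ω _ hne
    by_cases hcov : σ ⋖ ω
    · obtain ⟨l, hl, hω⟩ := covBy_iff.1 hcov
      have hlk : l ≠ k := fun h => hne (Subtype.ext (by rw [hω, h, hτ]))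
      have hx : (primeDivisor k).localEq ω ∈ ω.perp := mem_perp_iff.2 fun i hi => by
        rw [primeDivisor_spec k ω i hi, if_neg]
        rintro rfl
        rw [hω, Finset.mem_insert] at hi
        exact hi.elim (fun h => hlk h.symm) hk
      have hlω : l ∈ ω.1 := by rw [hω]; exact Finset.mem_insert_self _ _
      rw [coef_of_insert _ hl hω le_rfl, ← innerM_proj, proj_of_mem (perp_anti hcov.le hx),
        ← pairing_eq_innerM, mem_perp_iff.1 hx l hlω, zero_smul]
    · simp [Divisor.coef, hcov]
  · exact fun h => absurd (Finset.mem_univ τ) h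

/-- `Z_*(W)_ℚ` is generated by `[W]` as a module over `ℚ[Y₁, …, Yₙ₊₁]`. -/
theorem alpha_surjective (n : ℕ) : Function.Surjective (alpha n) := by
  have hS : ∀ (S : Finset (Fin (n + 1))) (hS : S ≠ Finset.univ),
      ∃ p, alpha n p = cycleOf ⟨S, hS⟩ := by
    intro S
    induction S using Finset.induction_on with
    | empty => exact fun _ => ⟨1, by rw [alpha_apply, map_one]; rfl⟩
    | insert k S hk ih =>
      intro h
      have hS' : S ≠ Finset.univ := fun he => hk (he ▸ Finset.mem_univ k)
      obtain ⟨p, hp⟩ := ih hS'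
      refine ⟨MvPolynomial.X k * p, ?_⟩
      rw [alpha_apply, map_mul, Module.End.mul_apply, ← alpha_apply, hp, polyAct_X]
      exact primeDivisor_act (σ := ⟨S, hS'⟩) (τ := ⟨insert k S, h⟩) hk rfl
  rw [← LinearMap.range_eq_top, eq_top_iff]
  intro z _
  have hz : z = ∑ σ, Cycle.coeff z σ • cycleOf σ := by
    refine (Finsupp.univ_sum_single (show Cone n →₀ ℚ from z)).symm.trans ?_
    refine Finset.sum_congr rfl fun σ _ => ?_
    have h : ∀ c : ℚ, (Finsupp.single σ c : Cone n →₀ ℚ) = c • Finsupp.single σ (1 : ℚ) := by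
      intro c
      rw [Finsupp.smul_single, smul_eq_mul, mul_one]
    exact h _
  rw [hz]
  exact Submodule.sum_mem _ fun σ _ => Submodule.smul_mem _ _ (hS σ.1 σ.2)

/-- The product of cycles: if `x = p · [W]`, then `x * y = p · y`. -/
noncomputable instance (n : ℕ) : Mul (Cycle n) :=
  ⟨fun x y => polyAct n (Function.surjInv (alpha_surjective n) x) y⟩

noncomputable instance (n : ℕ) : One (Cycle n) := ⟨fundamental n⟩

theorem alpha_mul_cycle {n : ℕ} (p : MvPolynomial (Fin (n + 1)) ℚ) (y : Cycle n) :
    alpha n p * y = polyAct n p y := by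
  obtain ⟨q, rfl⟩ := alpha_surjective n y
  have h : ∀ r : MvPolynomial (Fin (n + 1)) ℚ,
      polyAct n r (alpha n q) = polyAct n q (alpha n r) := by
    intro r
    rw [alpha_apply, alpha_apply, ← Module.End.mul_apply, ← Module.End.mul_apply, ← map_mul,
      ← map_mul, mul_comm]
  change polyAct n (Function.surjInv (alpha_surjective n) (alpha n p)) (alpha n q) = _
  rw [h, h, Function.surjInv_eq (alpha_surjective n)]

theorem alpha_mul {n : ℕ} (p q : MvPolynomial (Fin (n + 1)) ℚ) :
    alpha n (p * q) = alpha n p * alpha n q := by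
  rw [alpha_mul_cycle, alpha_apply, map_mul, Module.End.mul_apply, alpha_apply]

theorem alpha_one (n : ℕ) : alpha n 1 = 1 := by
  rw [alpha_apply, map_one]; rfl

/-- The ring structure on `Z_*(W)_ℚ`, for which `α` is a surjective ring homomorphism:
`Z_*(W)_ℚ ≅ ℚ[Y₁, …, Yₙ₊₁] / ker α`. -/
noncomputable instance (n : ℕ) : CommRing (Cycle n) where
  __ := (inferInstance : AddCommGroup (Cycle n))
  left_distrib x y z := by
    obtain ⟨p, rfl⟩ := alpha_surjective n x
    simp only [alpha_mul_cycle, map_add]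
  right_distrib x y z := by
    obtain ⟨p, rfl⟩ := alpha_surjective n x
    obtain ⟨q, rfl⟩ := alpha_surjective n y
    rw [← map_add, alpha_mul_cycle, alpha_mul_cycle, alpha_mul_cycle, map_add,
      LinearMap.add_apply]
  zero_mul x := by
    rw [← map_zero (alpha n), alpha_mul_cycle, map_zero, map_zero, LinearMap.zero_apply]
  mul_zero x := by
    obtain ⟨p, rfl⟩ := alpha_surjective n x
    rw [alpha_mul_cycle, map_zero]
  mul_assoc x y z := by
    obtain ⟨p, rfl⟩ := alpha_surjective n x
    obtain ⟨q, rfl⟩ := alpha_surjective n y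
    rw [← alpha_mul, alpha_mul_cycle, alpha_mul_cycle, alpha_mul_cycle, map_mul,
      Module.End.mul_apply]
  one_mul x := by
    rw [← alpha_one, alpha_mul_cycle, map_one, Module.End.one_apply]
  mul_one x := by
    obtain ⟨p, rfl⟩ := alpha_surjective n x
    rw [← alpha_one, ← alpha_mul, mul_one]
  mul_comm x y := by
    obtain ⟨p, rfl⟩ := alpha_surjective n x
    obtain ⟨q, rfl⟩ := alpha_surjective n y
    rw [← alpha_mul, ← alpha_mul, mul_comm]

/-! ## The Todd class -/

/-- The cycle of a divisor, `[D] = D · [W] = ∑ ⟨m_{ρᵢ}, vᵢ⟩ [V(ρᵢ)]`. -/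
noncomputable def Divisor.toCycle {n : ℕ} (D : Divisor n) : Cycle n :=
  D.act (fundamental n)

/-- The product with the cycle of `Dᵢ` is the action of the divisor `Dᵢ`. -/
theorem primeDivisor_toCycle_mul {n : ℕ} (i : Fin (n + 1)) (z : Cycle n) :
    (primeDivisor i).toCycle * z = (primeDivisor i).act z := by
  rw [← polyAct_X, ← alpha_mul_cycle, alpha_apply, polyAct_X]
  rfl

/-- The cycle of `Dᵢ` is `[V(ρᵢ)]`. -/
theorem primeDivisor_toCycle {n : ℕ} (i : Fin (n + 1)) (h : {i} ≠ Finset.univ) :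
    (primeDivisor i).toCycle = cycleOf ⟨{i}, h⟩ :=
  primeDivisor_act (Finset.notMem_empty i) rfl

/-- The divisor `Dᵢ` lowers the dimension of cycles, so it is nilpotent in `Z_*(W)_ℚ`. -/
theorem primeDivisor_toCycle_pow {n : ℕ} (i : Fin (n + 1)) :
    (primeDivisor i).toCycle ^ (n + 1) = 0 := by
  have key : ∀ k : ℕ, (primeDivisor i).toCycle ^ k ∈
      Submodule.span ℚ {z : Cycle n | ∃ σ : Cone n, k ≤ σ.1.card ∧ z = cycleOf σ} := by
    intro k
    induction k with
    | zero => exact Submodule.subset_span ⟨zeroCone n, Nat.zero_le _, pow_zero _⟩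
    | succ k ih =>
      rw [pow_succ', primeDivisor_toCycle_mul]
      have hle : Submodule.span ℚ {z : Cycle n | ∃ σ : Cone n, k ≤ σ.1.card ∧ z = cycleOf σ} ≤
          (Submodule.span ℚ {z : Cycle n | ∃ σ : Cone n, k + 1 ≤ σ.1.card ∧
            z = cycleOf σ}).comap (primeDivisor i).act := by
        rw [Submodule.span_le]
        rintro _ ⟨σ, hσ, rfl⟩
        rw [SetLike.mem_coe, Submodule.mem_comap, act_cycleOf]
        refine Submodule.sum_mem _ fun τ _ => ?_
        by_cases hcov : σ ⋖ τ
        · refine Submodule.smul_mem _ _ (Submodule.subset_span ⟨τ, ?_, rfl⟩)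
          have := Finset.card_lt_card (show σ.1 ⊂ τ.1 from hcov.lt)
          omega
        · simp [Divisor.coef, hcov]
      exact hle ih
  have hempty : {z : Cycle n | ∃ σ : Cone n, n + 1 ≤ σ.1.card ∧ z = cycleOf σ} = ∅ := by
    refine Set.eq_empty_iff_forall_notMem.2 ?_
    rintro _ ⟨σ, hσ, rfl⟩
    exact σ.2 (Finset.eq_univ_of_card _ (le_antisymm (Finset.card_le_univ _) (by simpa using hσ)))
  have h := key (n + 1)
  rwa [hempty, Submodule.span_empty, Submodule.mem_bot] at h

/-- The power series `Φ(x) = x / (1 - e^{-x})`, the inverse of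
`(1 - e^{-x}) / x = ∑ (-1)^k x^k / (k + 1)!`. -/
noncomputable def Phi : ℚ⟦X⟧ :=
  (PowerSeries.mk fun k => (-1 : ℚ) ^ k / ((k + 1)! : ℚ))⁻¹

theorem Phi_mul_one_sub_exp_neg :
    Phi * (1 - PowerSeries.evalNegHom (PowerSeries.exp ℚ)) = PowerSeries.X := by
  have h : (1 - PowerSeries.evalNegHom (PowerSeries.exp ℚ) : ℚ⟦X⟧) =
      PowerSeries.X * PowerSeries.mk fun k => (-1 : ℚ) ^ k / ((k + 1)! : ℚ) := by
    ext k
    cases k with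
    | zero => 
      rw [PowerSeries.coeff_zero_X_mul, map_sub, PowerSeries.evalNegHom,
        PowerSeries.coeff_rescale, PowerSeries.coeff_exp]
      simp
    | succ k =>
      rw [PowerSeries.coeff_succ_X_mul, PowerSeries.coeff_mk]
      simp [PowerSeries.evalNegHom, PowerSeries.coeff_rescale, PowerSeries.coeff_exp,
        PowerSeries.coeff_one, pow_succ]
      ring
  rw [h, mul_left_comm, Phi, PowerSeries.inv_mul_cancel _ (by simp), mul_one]

/-- `Φ(z)` for a cycle `z` with `z ^ (n + 1) = 0`, such as each `Dᵢ`: the power series is summed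
up to the exponent `n`, as all later terms vanish. -/
noncomputable def evalPhi {n : ℕ} (z : Cycle n) : Cycle n :=
  ∑ k ∈ Finset.range (n + 1), PowerSeries.coeff k Phi • z ^ k

/-- The cycle-level Todd class `t(W) = ∏ Φ(Dᵢ)`, the product in the ring `Z_*(W)_ℚ`. -/
noncomputable def toddClass (n : ℕ) : Cycle n :=
  ∏ i : Fin (n + 1), evalPhi (primeDivisor i).toCycle

/-! ## Solid angles -/

/-- The fraction of the linear span `L` of the cone `C` that is contained in `C`: the share of the
unit ball of `L` that lies in `C`, measured by the Lebesgue measure of the Euclidean space `L`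
(for `C = 0` the space `L` is a point, and the fraction is `1`). -/
noncomputable def solidAngle {E : Type*} [NormedAddCommGroup E] [InnerProductSpace ℝ E]
    [FiniteDimensional ℝ E] [MeasurableSpace E] [BorelSpace E] (C : PointedCone ℝ E) : ℝ :=
  MeasureTheory.volume.real
      {x : Submodule.span ℝ (C : Set E) | (x : E) ∈ C ∧ ‖x‖ ≤ 1} /
    MeasureTheory.volume.real {x : Submodule.span ℝ (C : Set E) | ‖x‖ ≤ 1}

end ToricProj

namespace ToricProj

/-! ## Coefficients of powers of `Φ` -/

/-! Let `S` be the index set of `σ`. Cut the cyclically ordered coordinates after each index outside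
`S`. This gives blocks of lengths `a k + 1`, in each of which exactly the last index is not in `S`
(`exists_blockDecomposition`). Both sides of the theorem equal `1 / ∏ (a k + 1)`, and both are
computed by rotating the blocks independently.

Solid angle (`BlockDecomposition.solidAngle_eq`): the span of `σ` consists of the vectors of cyclic
differences, block by block, of functions `Q`; here `Q` is determined up to a constant on each
block. Such a vector lies in `σ` exactly when `Q` is minimal at the last place of each block.
Prescribing other places for the minima gives the images of `σ` under rotations of the coordinates
in each block. These `∏ (a k + 1)` congruent cones cover the span and overlap in null sets.

Todd class (`coeff_toddClass`): the choice of orthogonal complements gives the relations `Dᵢ (2 Dᵢ -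
Dᵢ₋₁ - Dᵢ₊₁) = 0` (`primeDivisor_relation`). The functional `l`, which takes the coefficient of
`[V(σ)]`, kills every multiple of `Dⱼ` for `j ∉ S`, so indices may be read cyclically inside each
block. The sum of the rotates of `l` then kills all quadrics of the blocks and all full products
over a block. These two properties and the values on squarefree monomials determine a functional
(`functional_eq_zero`, by the maximum principle on cycles). Hence the sum is the much simpler
functional `cycleDegree`. The Todd polynomial is invariant under rotation, so `∏ (a k + 1)` times
its value under `l` is its value under `cycleDegree`, a product of coefficients of `x ^ m` in `Φ ^
(m + 1)`. Each of these is `1` (`coeff_Phi_pow_succ`). -/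

theorem X_mul_derivative_Phi :
    PowerSeries.X * PowerSeries.derivative ℚ Phi = Phi + PowerSeries.X * Phi - Phi ^ 2 := by
  set E : ℚ⟦X⟧ := PowerSeries.evalNegHom (PowerSeries.exp ℚ) with hE
  have hΦ : Phi * (1 - E) = PowerSeries.X := Phi_mul_one_sub_exp_neg
  have hdE : PowerSeries.derivative ℚ E = -E := by
    ext k
    simp only [hE, PowerSeries.evalNegHom, PowerSeries.coeff_derivative,
      PowerSeries.coeff_rescale, PowerSeries.coeff_exp, map_neg, Nat.factorial_succ]
    have : (k ! : ℚ) ≠ 0 := by positivity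
    have : (k + 1 : ℚ) ≠ 0 := by positivity
    simp
    field_simp
    ring
  have hd := congrArg (PowerSeries.derivative ℚ) hΦ
  rw [Derivation.leibniz, map_sub, hdE, PowerSeries.derivative_X] at hd
  simp only [smul_eq_mul, Derivation.map_one_eq_zero] at hd
  -- Differentiating `Φ (1 - E) = X` gives `Φ' (1 - E) + Φ E = 1`. Multiply by `Φ` and eliminate `E`
  -- with the original equation.
  linear_combination (Phi + PowerSeries.derivative ℚ Phi * (-1)) * hΦ + Phi * hd

/-- The differential equation of `Φ` expresses `X (Φ ^ (m + 1))'` through `Φ ^ (m + 1)` and `Φ ^ (m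
+ 2)`. In degree `m + 1` the coefficients of `Φ ^ (m + 1)` cancel, which leaves that the coefficient
of `Φ ^ (m + 2)` there equals the one of `Φ ^ (m + 1)` in degree `m`. -/
theorem coeff_Phi_pow_succ (m : ℕ) : PowerSeries.coeff m (Phi ^ (m + 1)) = 1 := by
  induction m with
  | zero => simp [Phi]
  | succ m ih =>
    have h : PowerSeries.X * PowerSeries.derivative ℚ (Phi ^ (m + 1)) =
        (m + 1 : ℕ) • (Phi ^ (m + 1) + PowerSeries.X * Phi ^ (m + 1) - Phi ^ (m + 2)) := by
      rw [Derivation.leibniz_pow, smul_eq_mul, Nat.add_sub_cancel, mul_smul_comm, mul_left_comm,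
        X_mul_derivative_Phi]
      congr 1
      ring
    have h' := congrArg (PowerSeries.coeff (m + 1)) h
    rw [PowerSeries.coeff_succ_X_mul, PowerSeries.coeff_derivative,
      map_nsmul, map_sub, map_add, PowerSeries.coeff_succ_X_mul, ih, nsmul_eq_mul] at h'
    push_cast at h'
    have h0 : (m + 1 : ℚ) ≠ 0 := by positivity
    have := mul_left_cancel₀ h0 ((mul_comm _ _).trans h')
    linarith

theorem coeff_trunc_Phi_pow_succ {m N : ℕ} (h : m < N) :
    ((PowerSeries.trunc N Phi) ^ (m + 1)).coeff m = 1 := by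
  have h1 := congrArg (fun p => p.coeff m) (PowerSeries.trunc_trunc_pow Phi N (m + 1))
  simp only [PowerSeries.coeff_trunc, if_pos h, coeff_Phi_pow_succ] at h1
  rw [← h1, ← Polynomial.coe_pow, Polynomial.coeff_coe]

/-! ## Polynomials in several groups of cyclically ordered variables -/

theorem coeff_prod_aeval_X {K : Type*} [Fintype K] (p : K → Polynomial ℚ) (m : K → ℕ) :
    MvPolynomial.coeff (Finsupp.equivFunOnFinite.symm m)
      (∏ k, Polynomial.aeval (MvPolynomial.X k : MvPolynomial K ℚ) (p k)) =
      ∏ k, (p k).coeff (m k) := by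
  classical
  have h : ∀ k, Polynomial.aeval (MvPolynomial.X k : MvPolynomial K ℚ) (p k) =
      ∑ j ∈ (p k).support, MvPolynomial.C ((p k).coeff j) * MvPolynomial.X k ^ j := by
    intro k
    rw [Polynomial.aeval_def, Polynomial.eval₂_eq_sum, Polynomial.sum_def]
    rfl
  simp only [h]
  rw [Finset.prod_univ_sum, MvPolynomial.coeff_sum]
  have h2 : ∀ x : K → ℕ, ∏ k, (MvPolynomial.C ((p k).coeff (x k)) * MvPolynomial.X k ^ x k :
      MvPolynomial K ℚ) =
      MvPolynomial.monomial (Finsupp.equivFunOnFinite.symm x) (∏ k, (p k).coeff (x k)) := by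
    intro x
    rw [Finset.prod_mul_distrib, ← map_prod, MvPolynomial.monomial_eq,
      Finsupp.prod_fintype _ _ (by simp)]
    rfl
  simp only [h2, MvPolynomial.coeff_monomial, Equiv.apply_eq_iff_eq]
  rw [Finset.sum_ite_eq']
  split_ifs with hm
  · rfl
  · rw [Fintype.mem_piFinset, not_forall] at hm
    obtain ⟨k, hk⟩ := hm
    exact (Finset.prod_eq_zero (Finset.mem_univ k) (Polynomial.notMem_support_iff.1 hk)).symm

/-! ### Rotations of cycles of variables and functionals that kill the quadrics -/

section Cycles

variable {K : Type*}

/-- The disjoint union of cycles of lengths `a k + 1`. -/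
abbrev Cycles (a : K → ℕ) : Type _ := Σ k, Fin (a k + 1)

/-- The rotation of each of the cycles. -/
def rot {a : K → ℕ} (g : ∀ k, Fin (a k + 1)) : Cycles a ≃ Cycles a :=
  Equiv.sigmaCongrRight fun k => Equiv.addRight (g k)

theorem rot_mk {a : K → ℕ} (g : ∀ k, Fin (a k + 1)) (k : K) (t : Fin (a k + 1)) :
    rot g ⟨k, t⟩ = ⟨k, t + g k⟩ := rfl

/-- The quadratic polynomial `Xₜ (2 Xₜ - Xₜ₋₁ - Xₜ₊₁)`, indices read cyclically. -/
noncomputable def quadric (a : K → ℕ) (k : K) (t : Fin (a k + 1)) :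
    MvPolynomial (Cycles a) ℚ :=
  MvPolynomial.X ⟨k, t⟩ * (2 * MvPolynomial.X ⟨k, t⟩ - MvPolynomial.X ⟨k, t - 1⟩ -
    MvPolynomial.X ⟨k, t + 1⟩)

theorem rename_rot_quadric {a : K → ℕ} (g : ∀ k, Fin (a k + 1)) (k : K) (t : Fin (a k + 1)) :
    MvPolynomial.rename (rot g) (quadric a k t) = quadric a k (t + g k) := by
  simp only [quadric, map_mul, map_sub, MvPolynomial.rename_X, rot_mk, map_ofNat,
    sub_add_eq_add_sub, add_right_comm t 1 (g k)]

open Fin.CommRing in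
theorem val_nsmul_one {n : ℕ} (x : Fin (n + 1)) : x.val • (1 : Fin (n + 1)) = x := by
  rw [nsmul_one, Fin.cast_val_eq_self]

/-- The maximum principle for discrete harmonic functions on cycles. -/
theorem nonpos_of_harmonic [Finite K] {a : K → ℕ} {T : Finset (Cycles a)}
    (hT : ∀ k, ∃ t, (⟨k, t⟩ : Cycles a) ∉ T) {u : Cycles a → ℚ} (h0 : ∀ i ∉ T, u i = 0)
    (h : ∀ k t, (⟨k, t⟩ : Cycles a) ∈ T → 2 * u ⟨k, t⟩ = u ⟨k, t - 1⟩ + u ⟨k, t + 1⟩)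
    (i : Cycles a) : u i ≤ 0 := by
  have : Nonempty (Cycles a) := ⟨i⟩
  obtain ⟨⟨k, t⟩, hmax⟩ := Finite.exists_max u
  by_contra! hi
  have hpos : 0 < u ⟨k, t⟩ := hi.trans_le (hmax i)
  -- At a positive maximum the point lies in `T` and the value is the mean of its neighbours, so the
  -- next point is a maximum too. Going round the cycle this reaches a point outside `T`, where `u`
  -- vanishes.
  have hs : ∀ s : ℕ, u ⟨k, t + s • 1⟩ = u ⟨k, t⟩ := by
    intro s
    induction s with
    | zero => simp
    | succ s ih =>
      have hmem : (⟨k, t + s • 1⟩ : Cycles a) ∈ T := by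
        by_contra hn
        rw [h0 _ hn] at ih
        exact hpos.ne ih
      have h1 := h k _ hmem
      have h2 := hmax ⟨k, t + s • 1 - 1⟩
      have h3 := hmax ⟨k, t + s • 1 + 1⟩
      rw [succ_nsmul, ← add_assoc]
      linarith
  obtain ⟨m, hm⟩ := hT k
  have h4 := hs (m - t).val
  rw [val_nsmul_one, add_sub_cancel, h0 _ hm] at h4
  exact hpos.ne h4

theorem eq_zero_of_harmonic [Finite K] {a : K → ℕ} {T : Finset (Cycles a)}
    (hT : ∀ k, ∃ t, (⟨k, t⟩ : Cycles a) ∉ T) {u : Cycles a → ℚ} (h0 : ∀ i ∉ T, u i = 0)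
    (h : ∀ k t, (⟨k, t⟩ : Cycles a) ∈ T → 2 * u ⟨k, t⟩ = u ⟨k, t - 1⟩ + u ⟨k, t + 1⟩)
    (i : Cycles a) : u i = 0 := by
  refine le_antisymm (nonpos_of_harmonic hT h0 h i) ?_
  have := nonpos_of_harmonic (u := fun i => -u i) hT (fun i hi => by rw [h0 i hi, neg_zero])
    (fun k t hk => by linarith [h k t hk]) i
  linarith

/-- Modulo the quadrics and the products over the cycles, each polynomial is a combination of
squarefree monomials. -/
theorem functional_eq_zero [Fintype K] [DecidableEq K] {a : K → ℕ}
    {μ : MvPolynomial (Cycles a) ℚ →ₗ[ℚ] ℚ}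
    (h1 : ∀ k t p, μ (quadric a k t * p) = 0)
    (h2 : ∀ k p, μ ((∏ t, MvPolynomial.X ⟨k, t⟩) * p) = 0)
    (h3 : ∀ T : Finset (Cycles a), μ (∏ i ∈ T, MvPolynomial.X i) = 0) : μ = 0 := by
  have key : ∀ (p : MvPolynomial (Cycles a) ℚ) (T : Finset (Cycles a)),
      μ (p * ∏ i ∈ T, MvPolynomial.X i) = 0 := by
    intro p
    induction p using MvPolynomial.induction_on with
    | C c => intro T; rw [← MvPolynomial.smul_eq_C_mul, map_smul, h3, smul_zero]
    | add p q hp hq => intro T; rw [add_mul, map_add, hp, hq, add_zero]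
    | mul_X m j ih =>
      intro T
      by_cases hT : ∀ k, ∃ t, (⟨k, t⟩ : Cycles a) ∉ T
      · refine eq_zero_of_harmonic hT (u := fun j => μ (m * MvPolynomial.X j *
          ∏ i ∈ T, MvPolynomial.X i)) (fun i hi => ?_) (fun k t hk => ?_) j
        · have := ih (insert i T)
          rwa [Finset.prod_insert hi, ← mul_assoc] at this
        · have := h1 k t (m * ∏ i ∈ T.erase ⟨k, t⟩, MvPolynomial.X i)
          rw [← Finset.mul_prod_erase T _ hk, ← sub_eq_zero, ← this]
          have h4 : ∀ q, 2 * μ q = μ (2 * q) := fun q => by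
            rw [two_mul, two_mul, map_add]
          rw [h4, ← map_add, ← map_sub, quadric]
          congr 1
          ring
      · push Not at hT
        obtain ⟨k, hk⟩ := hT
        have hsub : Finset.univ.map (Function.Embedding.sigmaMk k) ⊆ T := by
          intro i hi
          obtain ⟨t, _, rfl⟩ := Finset.mem_map.1 hi
          exact hk t
        rw [← Finset.prod_sdiff hsub, Finset.prod_map]
        have := h2 k (m * MvPolynomial.X j *
          ∏ i ∈ T \ Finset.univ.map (Function.Embedding.sigmaMk k), MvPolynomial.X i)
        rw [← this]
        congr 1
        simp only [Function.Embedding.sigmaMk_apply]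
        ring
  refine LinearMap.ext fun p => ?_
  have := key p ∅
  rwa [Finset.prod_empty, mul_one] at this

/-- Substitute the same variable for all variables of a cycle, and take the coefficient
whose degree in each cycle is one less than its length. -/
noncomputable def cycleDegree [Fintype K] (a : K → ℕ) : MvPolynomial (Cycles a) ℚ →ₗ[ℚ] ℚ :=
  (MvPolynomial.lcoeff ℚ (Finsupp.equivFunOnFinite.symm a)).comp
    (MvPolynomial.rename (R := ℚ) (Sigma.fst : Cycles a → K)).toLinearMap

theorem cycleDegree_apply [Fintype K] (a : K → ℕ) (p : MvPolynomial (Cycles a) ℚ) :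
    cycleDegree a p = MvPolynomial.coeff (Finsupp.equivFunOnFinite.symm a)
      (MvPolynomial.rename Sigma.fst p) := rfl

/-- With the variables of a cycle identified, the quadric becomes `X (2 X - X - X) = 0`. -/
theorem cycleDegree_quadric_mul [Fintype K] (a : K → ℕ) (k : K) (t : Fin (a k + 1))
    (p : MvPolynomial (Cycles a) ℚ) : cycleDegree a (quadric a k t * p) = 0 := by
  rw [cycleDegree_apply, map_mul, quadric]
  simp only [map_mul, map_sub, MvPolynomial.rename_X, map_ofNat]
  ring_nf
  simp

/-- The product becomes `X k ^ (a k + 1)`, whose exponent exceeds the degree `a k` that is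
extracted. -/
theorem cycleDegree_prod_mul [Fintype K] (a : K → ℕ) (k : K)
    (p : MvPolynomial (Cycles a) ℚ) :
    cycleDegree a ((∏ t, MvPolynomial.X ⟨k, t⟩) * p) = 0 := by
  rw [cycleDegree_apply, map_mul, map_prod]
  simp only [MvPolynomial.rename_X, Finset.prod_const, Finset.card_univ, Fintype.card_fin]
  rw [MvPolynomial.X_pow_eq_monomial, MvPolynomial.coeff_monomial_mul', if_neg]
  intro h
  have := h k
  simp at this

/-- The exponent of `X k` after the substitution counts the elements of `T` in the cycle `k`; it is
`a k` exactly when one element of the cycle is missing. -/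
theorem cycleDegree_squarefree [Fintype K] [DecidableEq K] (a : K → ℕ) (T : Finset (Cycles a)) :
    cycleDegree a (∏ i ∈ T, MvPolynomial.X i) =
      if ∀ k, ∃ t, ∀ s, (⟨k, s⟩ : Cycles a) ∈ T ↔ s ≠ t then 1 else 0 := by
  rw [cycleDegree_apply, map_prod]
  simp only [MvPolynomial.rename_X]
  have h : ∏ i ∈ T, (MvPolynomial.X i.1 : MvPolynomial K ℚ) =
      MvPolynomial.monomial (∑ i ∈ T, Finsupp.single i.1 1) 1 := by
    rw [MvPolynomial.monomial_sum_one]; rfl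
  rw [h, MvPolynomial.coeff_monomial]
  congr 1
  rw [eq_iff_iff, DFunLike.ext_iff]
  refine forall_congr' fun k => ?_
  have hcard : (∑ i ∈ T, Finsupp.single i.1 1 : K →₀ ℕ) k =
      (Finset.univ.filter fun s => (⟨k, s⟩ : Cycles a) ∈ T).card := by
    rw [Finsupp.finsetSum_apply]
    simp only [Finsupp.single_apply, Finset.sum_boole, Nat.cast_id]
    symm
    refine Finset.card_bij (fun s _ => ⟨k, s⟩) (by simp) (by simp) ?_
    rintro ⟨k', s⟩ hs
    obtain ⟨hs, rfl⟩ := Finset.mem_filter.1 hs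
    exact ⟨s, by simpa using hs, rfl⟩
  rw [hcard, Finsupp.equivFunOnFinite_symm_apply_apply]
  have hc := Finset.card_filter_add_card_filter_not
    (s := (Finset.univ : Finset (Fin (a k + 1)))) (fun s => (⟨k, s⟩ : Cycles a) ∈ T)
  rw [Finset.card_univ, Fintype.card_fin] at hc
  constructor
  · intro h
    have h1 : (Finset.univ.filter fun s => ¬ (⟨k, s⟩ : Cycles a) ∈ T).card = 1 := by omega
    obtain ⟨t, ht⟩ := Finset.card_eq_one.1 h1
    refine ⟨t, fun s => ?_⟩
    have := congrArg (s ∈ ·) ht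
    simp only [Finset.mem_filter_univ, Finset.mem_singleton, eq_iff_iff] at this
    rw [← not_iff_not, this, not_not]
  · rintro ⟨t, ht⟩
    have : (Finset.univ.filter fun s => ¬ (⟨k, s⟩ : Cycles a) ∈ T) = {t} := by
      ext s; simp [ht]
    rw [this, Finset.card_singleton] at hc
    omega

/-- A functional of the type "coefficient of the product of all variables that are not the last in
their cycle" takes the value `∏ 1 / (a k + 1)` on the Todd polynomial. -/
theorem functional_todd [Fintype K] [DecidableEq K] {a : K → ℕ} {N : ℕ} (hN : ∀ k, a k < N)
    {l : MvPolynomial (Cycles a) ℚ →ₗ[ℚ] ℚ}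
    (hlast : ∀ k p, l (MvPolynomial.X ⟨k, Fin.last _⟩ * p) = 0)
    (hquad : ∀ k t p, t ≠ Fin.last _ → l (quadric a k t * p) = 0)
    (hsq : ∀ T : Finset (Cycles a), l (∏ i ∈ T, MvPolynomial.X i) =
      if ∀ k t, (⟨k, t⟩ : Cycles a) ∈ T ↔ t ≠ Fin.last _ then 1 else 0) :
    l (∏ i, ∑ j ∈ Finset.range N, PowerSeries.coeff j Phi • MvPolynomial.X i ^ j) =
      (∏ k, ((a k : ℚ) + 1))⁻¹ := by
  set F : MvPolynomial (Cycles a) ℚ :=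
    ∏ i, ∑ j ∈ Finset.range N, PowerSeries.coeff j Phi • MvPolynomial.X i ^ j with hF
  -- The rotates of `l` sum to `cycleDegree`: each squarefree monomial that omits one variable per
  -- cycle is detected by exactly one rotation.
  have hsum : cycleDegree a - ∑ g : ∀ k, Fin (a k + 1),
      l.comp (MvPolynomial.rename (R := ℚ) (rot g)).toLinearMap = 0 := by
    refine functional_eq_zero (fun k t p => ?_) (fun k p => ?_) fun T => ?_
    · rw [LinearMap.sub_apply, cycleDegree_quadric_mul, LinearMap.sum_apply, zero_sub, neg_eq_zero]
      refine Finset.sum_eq_zero fun g _ => ?_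
      rw [LinearMap.comp_apply, AlgHom.toLinearMap_apply, map_mul, rename_rot_quadric]
      -- No relation is assumed at the last place, but there the quadric has the last variable as a
      -- factor.
      by_cases h : t + g k = Fin.last _
      · rw [h, quadric, mul_assoc, hlast]
      · exact hquad _ _ _ h
    · rw [LinearMap.sub_apply, cycleDegree_prod_mul, LinearMap.sum_apply, zero_sub, neg_eq_zero]
      refine Finset.sum_eq_zero fun g _ => ?_
      rw [LinearMap.comp_apply, AlgHom.toLinearMap_apply, map_mul, map_prod,
        ← Finset.mul_prod_erase _ _ (Finset.mem_univ (Fin.last (a k) - g k)), MvPolynomial.rename_X,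
        rot_mk, sub_add_cancel, mul_assoc, hlast]
    · rw [LinearMap.sub_apply, cycleDegree_squarefree, LinearMap.sum_apply, sub_eq_zero]
      have hg : ∀ g : ∀ k, Fin (a k + 1),
          (l.comp (MvPolynomial.rename (R := ℚ) (rot g)).toLinearMap) (∏ i ∈ T, MvPolynomial.X i) =
          if ∀ k s, (⟨k, s⟩ : Cycles a) ∈ T ↔ s ≠ Fin.last _ - g k then 1 else 0 := by
        intro g
        have : MvPolynomial.rename (rot g) (∏ i ∈ T, (MvPolynomial.X i : MvPolynomial _ ℚ)) =
            ∏ i ∈ T.map (rot g).toEmbedding, MvPolynomial.X i := by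
          rw [map_prod, Finset.prod_map]
          simp only [MvPolynomial.rename_X]
          rfl
        rw [LinearMap.comp_apply, AlgHom.toLinearMap_apply, this, hsq]
        congr 1
        rw [eq_iff_iff]
        refine forall_congr' fun k => ?_
        rw [← (Equiv.addRight (g k)).forall_congr_right]
        refine forall_congr' fun s => ?_
        have : (⟨k, Equiv.addRight (g k) s⟩ : Cycles a) = (rot g).toEmbedding ⟨k, s⟩ := rfl
        rw [this, Finset.mem_map' , Equiv.coe_addRight, ne_eq, ne_eq, eq_sub_iff_add_eq]
      simp only [hg]
      split_ifs with h
      · choose t ht using h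
        -- The only rotation that contributes moves the omitted place `t k` to the last place.
        rw [Finset.sum_eq_single_of_mem (fun k => Fin.last _ - t k) (Finset.mem_univ _), if_pos]
        · simpa using ht
        · intro g _ hne
          rw [if_neg]
          intro hc
          refine hne (funext fun k => ?_)
          have h1 := hc k (t k)
          rw [ht k (t k)] at h1
          simp only [ne_eq, not_true_eq_false, false_iff, not_not] at h1
          rw [h1, sub_sub_cancel]
      · symm
        refine Finset.sum_eq_zero fun g _ => ?_
        rw [if_neg]
        exact fun hc => h fun k => ⟨_, hc k⟩
  -- After the identification, `F` is the product over the cycles of `Φ ^ (a k + 1)`, truncated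
  -- harmlessly because `a k < N`.
  have hdeg : cycleDegree a F = 1 := by
    have hpoly : ∀ k, ∑ j ∈ Finset.range N,
        PowerSeries.coeff j Phi • (MvPolynomial.X k : MvPolynomial K ℚ) ^ j =
        Polynomial.aeval (MvPolynomial.X k) (PowerSeries.trunc N Phi) := by
      intro k
      rw [Polynomial.aeval_def, PowerSeries.eval₂_trunc_eq_sum_range]
      exact Finset.sum_congr rfl fun j _ => Algebra.smul_def _ _
    rw [cycleDegree_apply, hF, map_prod, Fintype.prod_sigma]
    simp only [map_sum, map_smul, map_pow, MvPolynomial.rename_X, Finset.prod_const,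
      Finset.card_univ, Fintype.card_fin, hpoly]
    simp only [← map_pow]
    rw [coeff_prod_aeval_X]
    exact Finset.prod_eq_one fun k _ => coeff_trunc_Phi_pow_succ (hN k)
  have hrot : ∀ g : ∀ k, Fin (a k + 1), MvPolynomial.rename (rot g) F = F := by
    intro g
    rw [hF, map_prod]
    simp only [map_sum, map_smul, map_pow, MvPolynomial.rename_X]
    exact Equiv.prod_comp (rot g) fun i => ∑ j ∈ Finset.range N,
      PowerSeries.coeff j Phi • (MvPolynomial.X i : MvPolynomial (Cycles a) ℚ) ^ j
  have h := LinearMap.congr_fun hsum F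
  rw [LinearMap.sub_apply, hdeg, LinearMap.sum_apply] at h
  simp only [LinearMap.comp_apply, AlgHom.toLinearMap_apply, hrot, Finset.sum_const,
    Finset.card_univ, Fintype.card_pi, Fintype.card_fin, LinearMap.zero_apply, nsmul_eq_mul] at h
  push_cast at h
  exact eq_inv_of_mul_eq_one_right (sub_eq_zero.1 h).symm

end Cycles

/-! ## Relations in the ring of cycles -/

theorem coeff_cycleOf {n : ℕ} (σ τ : Cone n) :
    (cycleOf σ).coeff τ = if σ = τ then 1 else 0 := by
  classical
  exact Finsupp.single_apply

/-- The coefficient of `[V(σ)]`, as a linear functional. -/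
def coeffHom {n : ℕ} (σ : Cone n) : Cycle n →ₗ[ℚ] ℚ :=
  Finsupp.lapply (M := ℚ) (R := ℚ) σ

theorem coeffHom_apply {n : ℕ} (σ : Cone n) (z : Cycle n) : coeffHom σ z = z.coeff σ := rfl

/-- Only facets of `σ` contribute to this coefficient, and each contribution involves `D` only
through its local equation on `σ`. -/
theorem coeffHom_act_eq_zero {n : ℕ} {σ : Cone n} {D : Divisor n}
    (h : D.localEq σ ∈ σ.perp) (z : Cycle n) : coeffHom σ (D.act z) = 0 := by
  classical
  suffices (coeffHom σ).comp D.act = 0 from LinearMap.congr_fun this z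
  refine Finsupp.lhom_ext' fun ω => LinearMap.ext_ring ?_
  change coeffHom σ (D.act (cycleOf ω)) = 0
  rw [act_cycleOf, map_sum]
  refine Finset.sum_eq_zero fun τ _ => ?_
  rw [map_smul, coeffHom_apply, coeff_cycleOf]
  split_ifs with hτ
  · subst hτ
    by_cases hcov : ω ⋖ τ
    · obtain ⟨k, hk, hkτ⟩ := covBy_iff.1 hcov
      rw [coef_of_insert _ hk hkτ le_rfl, ← innerM_proj, proj_of_mem (perp_anti hcov.le h),
        ← pairing_eq_innerM, mem_perp_iff.1 h k (by rw [hkτ]; exact Finset.mem_insert_self _ _),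
        zero_smul]
    · simp [Divisor.coef, hcov]
  · rw [smul_zero]

theorem coeffHom_primeDivisor_act {n : ℕ} {σ : Cone n} {j : Fin (n + 1)} (hj : j ∉ σ.1)
    (z : Cycle n) : coeffHom σ ((primeDivisor j).act z) = 0 := by
  refine coeffHom_act_eq_zero (mem_perp_iff.2 fun i hi => ?_) z
  rw [primeDivisor_spec j σ i hi, if_neg]
  rintro rfl
  exact hj hi

/-! ### Quadratic relations among the `Dᵢ` -/

theorem innerM_emb_v {n : ℕ} (i j : Fin (n + 1)) :
    innerM n (emb (v i)) (emb (v j)) = 2 * (if j = i then 1 else 0) -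
      (if j = i - 1 then 1 else 0) - (if j = i + 1 then 1 else 0) := by
  rw [← pairing_eq_innerM, pairing_v]
  simp only [emb, v, Pi.sub_apply, Pi.single_apply, add_left_inj, eq_sub_iff_add_eq]
  push_cast
  ring

/-- By the Gram matrix of the `vⱼ`, the divisor `2 Dᵢ - Dᵢ₋₁ - Dᵢ₊₁` has the global equation `emb (v
i)`. This vector is orthogonal to the annihilator of the ray through `vᵢ`, so the projection used in
the action on the cycle of that ray kills it. Here the choice of inner product matters. -/
theorem two_smul_act_sub_act_sub_act {n : ℕ} (i : Fin (n + 1)) (hi : {i} ≠ Finset.univ) :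
    (2 : ℚ) • (primeDivisor i).act (cycleOf ⟨{i}, hi⟩) -
      (primeDivisor (i - 1)).act (cycleOf ⟨{i}, hi⟩) -
      (primeDivisor (i + 1)).act (cycleOf ⟨{i}, hi⟩) = 0 := by
  set σ : Cone n := ⟨{i}, hi⟩
  rw [act_cycleOf, act_cycleOf, act_cycleOf, Finset.smul_sum, ← Finset.sum_sub_distrib,
    ← Finset.sum_sub_distrib]
  refine Finset.sum_eq_zero fun τ _ => ?_
  rw [smul_smul, ← sub_smul, ← sub_smul]
  by_cases hcov : σ ⋖ τ
  · obtain ⟨k, hk, hτ⟩ := covBy_iff.1 hcov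
    have hkτ : k ∈ τ.1 := by rw [hτ]; exact Finset.mem_insert_self _ _
    have hmem : (2 : ℚ) • (primeDivisor i).localEq τ - (primeDivisor (i - 1)).localEq τ -
        (primeDivisor (i + 1)).localEq τ - emb (v i) ∈ τ.perp := by
      refine mem_perp_iff.2 fun j hj => ?_
      rw [pairing_eq_innerM]
      simp only [map_sub, map_smul, LinearMap.sub_apply, LinearMap.smul_apply,
        ← pairing_eq_innerM, primeDivisor_spec _ τ j hj]
      rw [pairing_eq_innerM, innerM_emb_v, smul_eq_mul, sub_self]
    have h1 : innerM n ((2 : ℚ) • (primeDivisor i).localEq τ - (primeDivisor (i - 1)).localEq τ -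
        (primeDivisor (i + 1)).localEq τ - emb (v i)) (σ.proj (emb (v k))) = 0 := by
      rw [← innerM_proj, proj_of_mem (perp_anti hcov.le hmem), ← pairing_eq_innerM]
      exact mem_perp_iff.1 hmem k hkτ
    have h2 : innerM n (emb (v i)) (σ.proj (emb (v k))) = 0 := by
      rw [innerM_comm]
      exact innerM_perp_complement (proj_mem _ _) (emb_mem_complement (Finset.mem_singleton_self i))
    rw [map_sub, LinearMap.sub_apply, h2, sub_zero] at h1
    simp only [map_sub, map_smul, LinearMap.sub_apply, LinearMap.smul_apply, smul_eq_mul] at h1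
    rw [coef_of_insert _ hk hτ le_rfl, coef_of_insert _ hk hτ le_rfl,
      coef_of_insert _ hk hτ le_rfl, h1, zero_smul]
  · simp [Divisor.coef, hcov]

/-- `p ↦ p · [W]` as a homomorphism of rings. -/
noncomputable def alphaHom (n : ℕ) : MvPolynomial (Fin (n + 1)) ℚ →+* Cycle n where
  __ := alpha n
  map_one' := alpha_one n
  map_mul' := alpha_mul
  map_zero' := map_zero (alpha n)

theorem alphaHom_apply {n : ℕ} (p : MvPolynomial (Fin (n + 1)) ℚ) :
    alphaHom n p = alpha n p := rfl

theorem alphaHom_X {n : ℕ} (i : Fin (n + 1)) :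
    alphaHom n (MvPolynomial.X i) = (primeDivisor i).toCycle := by
  rw [alphaHom_apply, alpha_apply, polyAct_X]; rfl

theorem primeDivisor_relation {n : ℕ} (i : Fin (n + 1)) :
    (primeDivisor i).toCycle * (2 * (primeDivisor i).toCycle - (primeDivisor (i - 1)).toCycle -
      (primeDivisor (i + 1)).toCycle) = 0 := by
  -- For `n = 0` the ray is not a cone of the fan, and `Dᵢ` itself is zero.
  by_cases hi : ({i} : Finset (Fin (n + 1))) = Finset.univ
  · have hn : n = 0 := by
      have := congrArg Finset.card hi
      simpa using this.symm
    subst hn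
    have := primeDivisor_toCycle_pow i
    rw [zero_add, pow_one] at this
    rw [this, zero_mul]
  · have h := two_smul_act_sub_act_sub_act i hi
    rw [← primeDivisor_toCycle_mul, ← primeDivisor_toCycle_mul, ← primeDivisor_toCycle_mul,
      ← primeDivisor_toCycle i hi, two_smul] at h
    rw [← h]
    ring

theorem alphaHom_squarefree {n : ℕ} {T : Finset (Fin (n + 1))} (hT : T ≠ Finset.univ) :
    alphaHom n (∏ i ∈ T, MvPolynomial.X i) = cycleOf ⟨T, hT⟩ := by
  induction T using Finset.induction_on with
  | empty => rw [Finset.prod_empty, map_one]; rfl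
  | insert k S hk ih =>
    have hS : S ≠ Finset.univ := fun he => hk (he ▸ Finset.mem_univ k)
    rw [Finset.prod_insert hk, map_mul, ih hS, alphaHom_X, primeDivisor_toCycle_mul]
    exact primeDivisor_act (σ := ⟨S, hS⟩) (τ := ⟨insert k S, hT⟩) hk rfl

theorem coeffHom_alphaHom_X_mul {n : ℕ} {σ : Cone n} {j : Fin (n + 1)} (hj : j ∉ σ.1)
    (p : MvPolynomial (Fin (n + 1)) ℚ) :
    coeffHom σ (alphaHom n (MvPolynomial.X j * p)) = 0 := by
  rw [map_mul, alphaHom_X, primeDivisor_toCycle_mul, coeffHom_primeDivisor_act hj]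

/-- A proper subset gives a basis cycle; the product of all variables contains one whose index is
off `σ`, so it contributes nothing. -/
theorem coeffHom_alphaHom_squarefree {n : ℕ} (σ : Cone n) (T : Finset (Fin (n + 1))) :
    coeffHom σ (alphaHom n (∏ i ∈ T, MvPolynomial.X i)) = if T = σ.1 then 1 else 0 := by
  by_cases hT : T = Finset.univ
  · obtain ⟨j, hj⟩ : ∃ j, j ∉ σ.1 := by
      by_contra! h
      exact σ.2 (Finset.eq_univ_iff_forall.2 h)
    rw [if_neg (fun h : T = σ.1 => σ.2 (h.symm.trans hT)),
      ← Finset.mul_prod_erase T _ (hT ▸ Finset.mem_univ j),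
      coeffHom_alphaHom_X_mul hj]
  · rw [alphaHom_squarefree hT, coeffHom_apply, coeff_cycleOf]
    exact if_congr Subtype.ext_iff rfl rfl

theorem toddClass_eq {n : ℕ} : toddClass n = alphaHom n (∏ i, ∑ j ∈ Finset.range (n + 1),
    PowerSeries.coeff j Phi • MvPolynomial.X i ^ j) := by
  rw [toddClass, map_prod]
  refine Finset.prod_congr rfl fun i _ => ?_
  rw [evalPhi, map_sum]
  refine Finset.sum_congr rfl fun j _ => ?_
  rw [alphaHom_apply, map_smul, ← alphaHom_apply, map_pow, alphaHom_X]

/-! ## Blocks -/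

/-- A decomposition of the cyclically ordered coordinates into intervals, the elements of `S` being
those that are not the last in their interval. -/
structure BlockDecomposition {n : ℕ} (S : Finset (Fin (n + 1))) {K : Type*} (a : K → ℕ) where
  equiv : Cycles a ≃ Fin (n + 1)
  mem_iff : ∀ k t, equiv ⟨k, t⟩ ∈ S ↔ t ≠ Fin.last _
  succ_eq : ∀ k t, t ≠ Fin.last _ → equiv ⟨k, t⟩ + 1 = equiv ⟨k, t + 1⟩

open Fin.CommRing in
theorem add_one_nsmul_one (n : ℕ) : (n + 1) • (1 : Fin (n + 1)) = 0 := by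
  rw [nsmul_one, Fin.natCast_self]

/-- Each index outside `σ` is the last of its block, and `a j` counts the consecutive indices of `σ`
just before `j`. An index is located by its distance to the next index outside `σ`. -/
theorem exists_blockDecomposition {n : ℕ} (σ : Cone n) :
    ∃ a : {j // j ∉ σ.1} → ℕ, Nonempty (BlockDecomposition σ.1 a) := by
  classical
  obtain ⟨g, hg⟩ : ∃ g, g ∉ σ.1 := by
    by_contra! h
    exact σ.2 (Finset.eq_univ_iff_forall.2 h)
  have hprev : ∀ j : {j // j ∉ σ.1}, ∃ a : ℕ, j.1 - ((a + 1) • (1 : Fin (n + 1))) ∉ σ.1 ∧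
      ∀ d < a, j.1 - ((d + 1) • (1 : Fin (n + 1))) ∈ σ.1 := by
    intro j
    have h : ∃ d : ℕ, j.1 - ((d + 1) • (1 : Fin (n + 1))) ∉ σ.1 :=
      -- A full turn of `n + 1` steps leads back to `j`, so the search backwards ends.
      ⟨n, by rw [add_one_nsmul_one, sub_zero]; exact j.2⟩
    exact ⟨Nat.find h, Nat.find_spec h, fun d hd => not_not.1 (Nat.find_min h hd)⟩
  choose a ha ha' using hprev
  have hnext : ∀ i : Fin (n + 1), ∃ d : ℕ, i + d • (1 : Fin (n + 1)) ∉ σ.1 :=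
    fun i => ⟨(g - i).val, by rwa [val_nsmul_one, add_sub_cancel]⟩
  let f : Cycles a → Fin (n + 1) := fun i =>
    i.1.1 - ((a i.1 - i.2.val) • (1 : Fin (n + 1)))
  have hS : ∀ (j) (d : ℕ), 0 < d → d ≤ a j →
      j.1 - d • (1 : Fin (n + 1)) ∈ σ.1 := by
    intro j d h0 hd
    obtain ⟨d, rfl⟩ := Nat.exists_eq_succ_of_ne_zero h0.ne'
    exact ha' j d hd
  have hmem : ∀ k t, f ⟨k, t⟩ ∈ σ.1 ↔ t ≠ Fin.last _ := by
    intro k t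
    constructor
    · rintro h rfl
      apply k.2
      simpa [f] using h
    · intro ht
      have := Fin.val_lt_last ht
      exact hS k _ (Nat.sub_pos_of_lt this) (Nat.sub_le _ _)
  -- The distance recovers `t`, and the place reached recovers `k`; this yields injectivity.
  have hfind : ∀ k t, Nat.find (hnext (f ⟨k, t⟩)) = a k - t.val := by
    intro k t
    rw [Nat.find_eq_iff]
    refine ⟨by simpa [f] using k.2, fun d hd => not_not.2 ?_⟩
    have : f ⟨k, t⟩ + d • (1 : Fin (n + 1)) =
        k.1 - ((a k - t.val - d) • (1 : Fin (n + 1))) := by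
      rw [sub_nsmul _ hd.le]; simp only [f]; abel
    rw [this]
    exact hS k _ (by omega) (by omega)
  have hinj : Function.Injective f := by
    rintro ⟨k, t⟩ ⟨k', t'⟩ h
    have h1 := hfind k t
    rw [h, hfind k' t'] at h1
    have hk : k = k' := by
      have h2 : k.1 - ((a k - t.val) • (1 : Fin (n + 1))) =
        k'.1 - ((a k' - t'.val) • (1 : Fin (n + 1))) := h
      rw [h1, sub_left_inj] at h2
      exact Subtype.ext h2
    subst hk
    have := t.is_le
    have := t'.is_le
    have ht : t = t' := Fin.ext (by omega)
    rw [ht]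
  have hsurj : Function.Surjective f := by
    intro i
    let k : {j // j ∉ σ.1} := ⟨i + Nat.find (hnext i) • (1 : Fin (n + 1)), Nat.find_spec (hnext i)⟩
    have hle : Nat.find (hnext i) ≤ a k := by
      by_contra! hlt
      apply ha k
      have : k.1 - ((a k + 1) • (1 : Fin (n + 1))) =
          i + ((Nat.find (hnext i) - (a k + 1)) • (1 : Fin (n + 1))) := by
        rw [sub_nsmul _ hlt]; simp only [k]; abel
      rw [this]
      exact not_not.1 (Nat.find_min (hnext i) (by omega))
    refine ⟨⟨k, ⟨a k - Nat.find (hnext i), by omega⟩⟩, ?_⟩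
    simp only [f]
    rw [Nat.sub_sub_self hle]
    simp [k]
  refine ⟨a, ⟨⟨Equiv.ofBijective f ⟨hinj, hsurj⟩, hmem, ?_⟩⟩⟩
  intro k t ht
  have h1 := Fin.val_lt_last ht
  change f ⟨k, t⟩ + 1 = f ⟨k, t + 1⟩
  simp only [f]
  rw [Fin.val_add_one_of_lt (Fin.lt_last_iff_ne_last.2 ht)]
  have h2 : a k - t.val = (a k - (t.val + 1)) + 1 := by omega
  rw [h2, succ_nsmul]
  abel

namespace BlockDecomposition

variable {n : ℕ} {S : Finset (Fin (n + 1))} {K : Type*} {a : K → ℕ}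

theorem last_notMem (B : BlockDecomposition S a) (k : K) : B.equiv ⟨k, Fin.last _⟩ ∉ S :=
  fun h => (B.mem_iff k _).1 h rfl

theorem pred_eq (B : BlockDecomposition S a) {k : K} {t : Fin (a k + 1)}
    (h : t - 1 ≠ Fin.last _) : B.equiv ⟨k, t⟩ - 1 = B.equiv ⟨k, t - 1⟩ := by
  have h2 := B.succ_eq k _ h
  rw [sub_add_cancel] at h2
  rw [← h2, add_sub_cancel_right]

/-- If the predecessor of the first index of a block were in `S`, it would not be last in its own
block, so that block would continue with the given index. -/
theorem pred_notMem (B : BlockDecomposition S a) {k : K} {t : Fin (a k + 1)}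
    (h : t - 1 = Fin.last _) : B.equiv ⟨k, t⟩ - 1 ∉ S := by
  intro hmem
  obtain ⟨⟨k', t'⟩, he⟩ := B.equiv.surjective (B.equiv ⟨k, t⟩ - 1)
  rw [← he, B.mem_iff] at hmem
  have h2 := B.succ_eq k' t' hmem
  rw [he, sub_add_cancel, B.equiv.apply_eq_iff_eq] at h2
  obtain rfl : k = k' := congrArg Sigma.fst h2
  rw [eq_of_heq (Sigma.mk.inj h2).2, add_sub_cancel_right] at h
  exact hmem h

end BlockDecomposition

/-! ### The coefficient of the Todd class -/

theorem coeff_toddClass {n : ℕ} (σ : Cone n) {K : Type*} [Fintype K] {a : K → ℕ}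
    (B : BlockDecomposition σ.1 a) :
    (toddClass n).coeff σ = (∏ k, ((a k : ℚ) + 1))⁻¹ := by
  classical
  have hN : ∀ k, a k < n + 1 := by
    intro k
    have := Fintype.card_le_of_injective (fun t => B.equiv ⟨k, t⟩)
      (B.equiv.injective.comp sigma_mk_injective)
    simpa using this
  let l : MvPolynomial (Cycles a) ℚ →ₗ[ℚ] ℚ := (coeffHom σ).comp
    ((alpha n).comp (MvPolynomial.rename (R := ℚ) B.equiv).toLinearMap)
  have hl : ∀ p, l p = coeffHom σ (alphaHom n (MvPolynomial.rename B.equiv p)) := fun _ => rfl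
  have key := functional_todd hN (l := l) (fun k p => ?_) (fun k t p ht => ?_) fun T => ?_
  · rw [← key, hl, map_prod, ← coeffHom_apply, toddClass_eq]
    simp only [map_sum, map_smul, map_pow, MvPolynomial.rename_X]
    rw [Equiv.prod_comp B.equiv fun i => ∑ j ∈ Finset.range (n + 1),
      PowerSeries.coeff j Phi • (MvPolynomial.X i : MvPolynomial (Fin (n + 1)) ℚ) ^ j]
  · rw [hl, map_mul, MvPolynomial.rename_X, coeffHom_alphaHom_X_mul (B.last_notMem k)]
  · rw [hl, quadric]
    simp only [map_mul, map_sub, MvPolynomial.rename_X, map_ofNat, ← B.succ_eq k t ht, alphaHom_X]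
    set i := B.equiv ⟨k, t⟩ with hi
    -- At the start of a block the predecessor within the block and the predecessor among all
    -- coordinates may differ. Both then lie outside `σ`, so both terms have coefficient zero.
    have hprev : ∀ z, coeffHom σ ((primeDivisor (B.equiv ⟨k, t - 1⟩)).toCycle * z) =
        coeffHom σ ((primeDivisor (i - 1)).toCycle * z) := by
      intro z
      by_cases h : t - 1 = Fin.last _
      · rw [h, primeDivisor_toCycle_mul, primeDivisor_toCycle_mul,
          coeffHom_primeDivisor_act (B.last_notMem k), coeffHom_primeDivisor_act (B.pred_notMem h)]
      · rw [hi, B.pred_eq h]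
    have h0 := congrArg (fun w => coeffHom σ (w * alphaHom n (MvPolynomial.rename B.equiv p)))
      (primeDivisor_relation i)
    simp only [zero_mul, map_zero] at h0
    rw [← h0]
    have e1 : ∀ x y z w u : Cycle n, x * (2 * x - y - z) * w =
        2 * x * x * w - y * (x * w) - x * z * w := by intros; ring
    rw [e1 _ _ _ _ 0, e1 _ _ _ _ 0, map_sub, map_sub, map_sub, map_sub, hprev]
  · have : MvPolynomial.rename B.equiv (∏ i ∈ T, (MvPolynomial.X i : MvPolynomial _ ℚ)) =
        ∏ i ∈ T.map B.equiv.toEmbedding, MvPolynomial.X i := by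
      rw [map_prod, Finset.prod_map]
      simp only [MvPolynomial.rename_X]
      rfl
    rw [hl, this, coeffHom_alphaHom_squarefree]
    congr 1
    rw [eq_iff_iff, Finset.ext_iff, ← B.equiv.forall_congr_right, Sigma.forall]
    refine forall_congr' fun k => forall_congr' fun t => ?_
    rw [B.mem_iff, ← Equiv.coe_toEmbedding, Finset.mem_map']

/-! ## The solid angle -/

/-- Isometries preserve the unit ball and the volume, so every piece meets the ball in the same
volume as `C`. As overlaps are null, the ball has `Fintype.card G` times that volume. -/
theorem solidAngle_eq_of_tiling {E : Type*} [NormedAddCommGroup E] [InnerProductSpace ℝ E]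
    [FiniteDimensional ℝ E] [MeasurableSpace E] [BorelSpace E] {C : PointedCone ℝ E}
    {G : Type*} [Fintype G] {D : G → Set (Submodule.span ℝ (C : Set E))}
    (hmeas : ∀ g, MeasurableSet (D g)) (hcover : ∀ x, ∃ g, x ∈ D g)
    (hnull : ∀ g g', g ≠ g' → MeasureTheory.volume (D g ∩ D g') = 0)
    (hiso : ∀ g, ∃ R : Submodule.span ℝ (C : Set E) ≃ₗᵢ[ℝ] Submodule.span ℝ (C : Set E),
      ∀ x, x ∈ D g ↔ (R x : E) ∈ C) :
    solidAngle C = (Fintype.card G : ℝ)⁻¹ := by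
  set U : Set (Submodule.span ℝ (C : Set E)) := {x | ‖x‖ ≤ 1} with hU
  set A : Set (Submodule.span ℝ (C : Set E)) := {x | (x : E) ∈ C ∧ ‖x‖ ≤ 1} with hA
  have hUball : U = Metric.closedBall 0 1 := by ext x; simp [hU]
  have hUmeas : MeasurableSet U := hUball ▸ measurableSet_closedBall
  have hDA : ∀ g, MeasureTheory.volume (D g ∩ U) = MeasureTheory.volume A := by
    intro g
    obtain ⟨R, hR⟩ := hiso g
    have : D g ∩ U = R ⁻¹' A := by
      ext x
      simp only [hU, hA, Set.mem_inter_iff, Set.mem_preimage, Set.mem_ofPred_eq, hR,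
        LinearIsometryEquiv.norm_map]
    rw [this]
    exact R.measurePreserving.measure_preimage_equiv (f := R.toMeasurableEquiv) A
  have hUnion : U = ⋃ g, D g ∩ U := by
    rw [← Set.iUnion_inter, Set.iUnion_eq_univ_iff.2 hcover, Set.univ_inter]
  have hvol : MeasureTheory.volume U = Fintype.card G * MeasureTheory.volume A := by
    conv_lhs => rw [hUnion]
    rw [MeasureTheory.measure_iUnion₀ (fun g g' h => MeasureTheory.measure_mono_null
        (Set.inter_subset_inter Set.inter_subset_left Set.inter_subset_left) (hnull g g' h))
      fun g => ((hmeas g).inter hUmeas).nullMeasurableSet, tsum_fintype]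
    simp [hDA]
  have hreal : MeasureTheory.volume.real U = Fintype.card G * MeasureTheory.volume.real A := by
    simp [MeasureTheory.measureReal_def, hvol]
  have hpos : MeasureTheory.volume.real U ≠ 0 := by
    rw [hUball]
    exact (ENNReal.toReal_pos (Metric.measure_closedBall_pos _ _ one_pos).ne'
      MeasureTheory.measure_closedBall_lt_top.ne).ne'
  change MeasureTheory.volume.real A / MeasureTheory.volume.real U = _
  rw [hreal] at hpos ⊢
  rw [mul_comm, div_mul_cancel_left₀ (right_ne_zero_of_mul hpos)]

/-! ### Coordinates on the span of a cone, and its tiling by block rotations -/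

namespace BlockDecomposition

variable {n : ℕ} {S : Finset (Fin (n + 1))} {K : Type*} {a : K → ℕ}

/-- The vector whose coordinates are the cyclic differences of a function. -/
def diff (B : BlockDecomposition S a) :
    (Cycles a → ℝ) →ₗ[ℝ] EuclideanSpace ℝ (Fin (n + 1)) where
  toFun Q := WithLp.toLp 2 fun i =>
    Q (B.equiv.symm i) - Q ⟨(B.equiv.symm i).1, (B.equiv.symm i).2 - 1⟩
  map_add' Q Q' := by
    ext i
    simp only [Pi.add_apply, PiLp.add_apply]
    ring
  map_smul' c Q := by
    ext i
    simp only [Pi.smul_apply, PiLp.smul_apply, smul_eq_mul, RingHom.id_apply]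
    ring

theorem diff_apply (B : BlockDecomposition S a) (Q : Cycles a → ℝ) (k : K) (t : Fin (a k + 1)) :
    B.diff Q (B.equiv ⟨k, t⟩) = Q ⟨k, t⟩ - Q ⟨k, t - 1⟩ := by
  change Q (B.equiv.symm (B.equiv ⟨k, t⟩)) - Q ⟨(B.equiv.symm (B.equiv ⟨k, t⟩)).1,
    (B.equiv.symm (B.equiv ⟨k, t⟩)).2 - 1⟩ = _
  rw [B.equiv.symm_apply_apply]

theorem euclidean_ext (B : BlockDecomposition S a) {x y : EuclideanSpace ℝ (Fin (n + 1))}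
    (h : ∀ k t, x (B.equiv ⟨k, t⟩) = y (B.equiv ⟨k, t⟩)) : x = y := by
  ext i
  obtain ⟨⟨k, t⟩, rfl⟩ := B.equiv.surjective i
  exact h k t

/-- The coordinate of `∑ cᵢ vᵢ` at `l` is `c_l - c_{l-1}`, absent coefficients being zero.
Normalised to vanish at the last places, `Q` is thus the family of coefficients with respect to the
ray generators. -/
theorem diff_eq_sum (B : BlockDecomposition S a) {Q : Cycles a → ℝ}
    (hQ : ∀ k, Q ⟨k, Fin.last _⟩ = 0) :
    B.diff Q = ∑ i ∈ S, Q (B.equiv.symm i) • toReal (v i) := by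
  refine B.euclidean_ext fun k t => ?_
  rw [diff_apply]
  set l := B.equiv ⟨k, t⟩ with hl
  have h1 : (∑ i ∈ S, Q (B.equiv.symm i) • toReal (v i) : EuclideanSpace ℝ (Fin (n + 1))) l =
      (if l ∈ S then Q (B.equiv.symm l) else 0) -
        (if l - 1 ∈ S then Q (B.equiv.symm (l - 1)) else 0) := by
    rw [WithLp.ofLp_sum, Finset.sum_apply, ← Finset.sum_ite_eq S l fun i => Q (B.equiv.symm i),
      ← Finset.sum_ite_eq S (l - 1) fun i => Q (B.equiv.symm i),
      ← Finset.sum_sub_distrib]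
    refine Finset.sum_congr rfl fun i _ => ?_
    simp only [toReal, v, PiLp.smul_apply, Pi.sub_apply, Pi.single_apply, smul_eq_mul,
      sub_eq_iff_eq_add]
    push_cast
    split_ifs <;> simp
  rw [h1]
  congr 1
  · by_cases h : t = Fin.last _
    · rw [hl, h, hQ, if_neg (B.last_notMem k)]
    · rw [hl, if_pos ((B.mem_iff k t).2 h), B.equiv.symm_apply_apply]
  · by_cases h : t - 1 = Fin.last _
    · rw [if_neg (B.pred_notMem h), h, hQ]
    · rw [hl, B.pred_eq h, if_pos ((B.mem_iff k _).2 h), B.equiv.symm_apply_apply]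

theorem eq_of_diff_eq_zero (B : BlockDecomposition S a) {Q : Cycles a → ℝ} (h : B.diff Q = 0)
    (k : K) (s t : Fin (a k + 1)) : Q ⟨k, s⟩ = Q ⟨k, t⟩ := by
  have h1 : ∀ d : ℕ, Q ⟨k, t + d • 1⟩ = Q ⟨k, t⟩ := by
    intro d
    induction d with
    | zero => simp
    | succ d ih =>
      have h2 := B.diff_apply Q k (t + (d + 1) • 1)
      rw [h, succ_nsmul, ← add_assoc, add_sub_cancel_right, ih] at h2
      rw [succ_nsmul, ← add_assoc]
      exact (sub_eq_zero.1 h2.symm)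
  have h3 := h1 (s - t).val
  rwa [val_nsmul_one, add_sub_cancel] at h3

theorem diff_eq_zero (B : BlockDecomposition S a) (q : K → ℝ) :
    B.diff (fun i => q i.1) = 0 :=
  B.euclidean_ext fun k t => by rw [diff_apply, sub_self]; rfl

theorem diff_sub_last (B : BlockDecomposition S a) (Q : Cycles a → ℝ) :
    B.diff Q = B.diff (fun i => Q i - Q ⟨i.1, Fin.last _⟩) := by
  have := B.diff_eq_zero fun k => Q ⟨k, Fin.last _⟩
  rw [← sub_eq_zero, ← map_sub, ← this]
  congr 1
  ext i
  simp

/-- Subtracting from `Q` its last value in each block does not change the differences. The new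
values are the coefficients of the `vᵢ`, and they are nonnegative exactly when the last value is
minimal. -/
theorem mem_cone_iff {σ : Cone n} (B : BlockDecomposition σ.1 a)
    (x : EuclideanSpace ℝ (Fin (n + 1))) :
    x ∈ σ.toPointedCone ↔ ∃ Q, B.diff Q = x ∧ ∀ k t, Q ⟨k, Fin.last _⟩ ≤ Q ⟨k, t⟩ := by
  rw [mem_toPointedCone_iff]
  constructor
  · rintro ⟨c, rfl⟩
    refine ⟨fun i => if i.2 = Fin.last _ then 0 else c (B.equiv i), ?_, fun k t => ?_⟩
    · rw [diff_eq_sum B fun k => if_pos rfl]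
      refine Finset.sum_congr rfl fun i hi => ?_
      obtain ⟨⟨k, t⟩, rfl⟩ := B.equiv.surjective i
      rw [B.equiv.symm_apply_apply, if_neg ((B.mem_iff k t).1 hi)]
      rfl
    · dsimp only
      rw [if_pos rfl]
      split_ifs
      · exact le_rfl
      · exact (c _).2
  · rintro ⟨Q, rfl, hQ⟩
    refine ⟨fun i => ⟨Q (B.equiv.symm i) - Q ⟨(B.equiv.symm i).1, Fin.last _⟩,
      sub_nonneg.2 (hQ _ _)⟩, ?_⟩
    rw [diff_sub_last, diff_eq_sum B fun k => sub_self _]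
    rfl

theorem span_cone_eq {σ : Cone n} (B : BlockDecomposition σ.1 a) :
    Submodule.span ℝ (σ.toPointedCone : Set (EuclideanSpace ℝ (Fin (n + 1)))) =
      LinearMap.range B.diff := by
  refine le_antisymm (Submodule.span_le.2 fun x hx => ?_) ?_
  · obtain ⟨Q, hQ, _⟩ := (B.mem_cone_iff x).1 hx
    exact ⟨Q, hQ⟩
  · rintro _ ⟨Q, rfl⟩
    rw [diff_sub_last, diff_eq_sum B fun k => sub_self _]
    exact Submodule.sum_mem _ fun i hi => Submodule.smul_mem _ _
      (Submodule.subset_span (Submodule.subset_span ⟨i, hi, rfl⟩))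

/-- The isometry that rotates the coordinates in each block. -/
noncomputable def rotate (B : BlockDecomposition S a) (g : ∀ k, Fin (a k + 1)) :
    EuclideanSpace ℝ (Fin (n + 1)) ≃ₗᵢ[ℝ] EuclideanSpace ℝ (Fin (n + 1)) :=
  LinearIsometryEquiv.piLpCongrLeft 2 ℝ ℝ ((B.equiv.symm.trans (rot g)).trans B.equiv)

theorem rotate_diff (B : BlockDecomposition S a) (g : ∀ k, Fin (a k + 1)) (Q : Cycles a → ℝ) :
    B.rotate g (B.diff Q) = B.diff (Q ∘ (rot g).symm) := by
  refine B.euclidean_ext fun k t => ?_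
  rw [diff_apply]
  have h : ∀ s, (rot g).symm ⟨k, s⟩ = ⟨k, s - g k⟩ := fun s => by
    rw [Equiv.symm_apply_eq, rot_mk, sub_add_cancel]
  have : B.rotate g (B.diff Q) (B.equiv ⟨k, t⟩) = B.diff Q (B.equiv ((rot g).symm ⟨k, t⟩)) := by
    simp [rotate, LinearIsometryEquiv.piLpCongrLeft_apply, Equiv.piCongrLeft'_apply]
  rw [this, Function.comp_apply, Function.comp_apply, h, h, diff_apply, sub_right_comm]

theorem solidAngle_eq {σ : Cone n} [Fintype K] (B : BlockDecomposition σ.1 a) :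
    solidAngle σ.toPointedCone = (∏ k, ((a k : ℝ) + 1))⁻¹ := by
  classical
  set L := Submodule.span ℝ (σ.toPointedCone : Set (EuclideanSpace ℝ (Fin (n + 1)))) with hL
  have hrange : ∀ Q, B.diff Q ∈ L := fun Q => by
    rw [hL, B.span_cone_eq]; exact ⟨Q, rfl⟩
  -- A linear section `s` chooses a `Q` for each vector of the span. The choice is irrelevant, as
  -- only comparisons within a block are used, and these do not depend on it.
  obtain ⟨s, hs⟩ := (B.diff.codRestrict L hrange).exists_rightInverse_of_surjective (by
    rw [LinearMap.range_eq_top]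
    rintro ⟨x, hx⟩
    rw [hL, B.span_cone_eq] at hx
    obtain ⟨Q, rfl⟩ := hx
    exact ⟨Q, rfl⟩)
  have hs' : ∀ x : L, B.diff (s x) = x := fun x =>
    congrArg Subtype.val (LinearMap.congr_fun hs x)
  have hcont : Continuous s := s.continuous_of_finiteDimensional
  have hindep : ∀ (x : L) (Q), B.diff Q = x → ∀ k t u,
      s x ⟨k, t⟩ ≤ s x ⟨k, u⟩ ↔ Q ⟨k, t⟩ ≤ Q ⟨k, u⟩ := by
    intro x Q hQ k t u
    have h := B.eq_of_diff_eq_zero (Q := s x - Q) (by rw [map_sub, hs', hQ, sub_self]) k t u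
    rw [Pi.sub_apply, Pi.sub_apply] at h
    constructor <;> intro <;> linarith
  have hcone : ∀ x : L, (x : EuclideanSpace ℝ (Fin (n + 1))) ∈ σ.toPointedCone ↔
      ∀ k t, s x ⟨k, Fin.last _⟩ ≤ s x ⟨k, t⟩ := by
    intro x
    rw [B.mem_cone_iff]
    exact ⟨fun ⟨Q, hQ, h⟩ k t => (hindep x Q hQ k _ _).2 (h k t), fun h => ⟨s x, hs' x, h⟩⟩
  have hcard : (∏ k, ((a k : ℝ) + 1)) = (Fintype.card (∀ k, Fin (a k + 1)) : ℝ) := by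
    simp [Fintype.card_pi]
  rw [hcard]
  -- The tile of `m` consists of the vectors whose `Q` attains its minimum over the block `k` at `m
  -- k`.
  refine solidAngle_eq_of_tiling
    (D := fun m => {x | ∀ k t, s x ⟨k, m k⟩ ≤ s x ⟨k, t⟩}) (fun m => ?_) (fun x => ?_)
    (fun m m' hm => ?_) fun m => ?_
  · refine IsClosed.measurableSet ?_
    simp only [Set.ofPred_forall]
    exact isClosed_iInter fun k => isClosed_iInter fun t =>
      isClosed_le ((continuous_apply _).comp hcont) ((continuous_apply _).comp hcont)
  · choose m hm using fun k => Finite.exists_min fun t => s x ⟨k, t⟩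
    exact ⟨m, hm⟩
  -- On the overlap two different places of one block carry equal values. This is the kernel of a
  -- linear form, nonzero because the indicator function of `⟨k, m k⟩` separates the two places.
  · obtain ⟨k, hk⟩ := Function.ne_iff.1 hm
    let l : L →ₗ[ℝ] ℝ := (LinearMap.proj ⟨k, m k⟩ - LinearMap.proj ⟨k, m' k⟩ :
      (Cycles a → ℝ) →ₗ[ℝ] ℝ).comp s
    have hker : LinearMap.ker l ≠ ⊤ := by
      intro h
      let Q : Cycles a → ℝ := Pi.single ⟨k, m k⟩ 1
      have h1 : (⟨B.diff Q, hrange Q⟩ : L) ∈ LinearMap.ker l := h ▸ Submodule.mem_top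
      have h2 : s ⟨B.diff Q, hrange Q⟩ ⟨k, m k⟩ = s ⟨B.diff Q, hrange Q⟩ ⟨k, m' k⟩ :=
        sub_eq_zero.1 h1
      have h3 := (hindep ⟨B.diff Q, hrange Q⟩ Q rfl k (m k) (m' k)).1 h2.le
      have h4 : Q ⟨k, m' k⟩ = 0 := Pi.single_eq_of_ne (by simpa using hk.symm) _
      rw [h4] at h3
      norm_num [Q] at h3
    refine MeasureTheory.measure_mono_null ?_ (MeasureTheory.Measure.addHaar_submodule _ _ hker)
    rintro x ⟨h1, h2⟩
    exact sub_eq_zero.2 (le_antisymm (h1 k _) (h2 k _))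
  -- This rotation moves the place `m k` of the minimum to the last place, hence the tile onto the
  -- cone.
  · set g : ∀ k, Fin (a k + 1) := fun k => Fin.last _ - m k with hg
    have hmaps : ∀ x ∈ L, (B.rotate g).toLinearEquiv.toLinearMap x ∈ L := by
      intro x hx
      rw [hL, B.span_cone_eq] at hx
      obtain ⟨Q, rfl⟩ := hx
      change B.rotate g (B.diff Q) ∈ L
      rw [rotate_diff]
      exact hrange _
    let R : L →ₗᵢ[ℝ] L := ⟨(B.rotate g).toLinearEquiv.toLinearMap.restrict hmaps,
      fun x => (B.rotate g).norm_map x⟩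
    refine ⟨R.toLinearIsometryEquiv rfl, fun x => ?_⟩
    have hR : B.diff (s x ∘ (rot g).symm) = (R x : EuclideanSpace ℝ (Fin (n + 1))) := by
      rw [← rotate_diff, hs']; rfl
    rw [LinearIsometry.coe_toLinearIsometryEquiv, hcone]
    refine forall_congr' fun k => ?_
    have h : ∀ t, (rot g).symm ⟨k, t⟩ = ⟨k, t - g k⟩ := fun t => by
      rw [Equiv.symm_apply_eq, rot_mk, sub_add_cancel]
    rw [← (Equiv.subRight (g k)).forall_congr_right]
    refine forall_congr' fun t => ?_
    rw [hindep _ _ hR, Function.comp_apply, Function.comp_apply, h, h, hg, sub_sub_cancel]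
    rfl

end BlockDecomposition

end ToricProj

open ToricProj in
/-- For every cone `σ` of the fan, the coefficient of `[V(σ)]` in the cycle-level Todd class
`t(W)` is the fraction of the linear span of `σ` that is contained in `σ`. -/
theorem theorem12p1 (n : ℕ) (σ : Cone n) :
    ((toddClass n).coeff σ : ℝ) = solidAngle σ.toPointedCone := by
  obtain ⟨a, ⟨B⟩⟩ := exists_blockDecomposition σ
  rw [coeff_toddClass σ B, B.solidAngle_eq]
  push_cast
  rfl
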